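/- Let $k\ge 2$. For a $k$-uniform hypergraph $H=(V,E)$ with $V=\{1,\dots,n\}$ and $m=|E|$ hyperedges, a $k$-simplex in $H$ is a set of $k+1$ vertices all of whose $k$-element subsets are hyperedges of $H$, and $T_k(H)$ is the number of $k$-simplices in $H$. (1) There is a randomized streaming algorithm that makes $4$ passes over a stream listing the hyperedges of $H$ (each exactly once, in arbitrary order), is given the parameters $n$, $m$, $T>0$, $0<\varepsilon\le 1$ and $0<\delta<1$, and has the following property. Whenever $T_k(H)\ge T$, then for every order of the stream its output $Y$ satisfies $$\Pr\big[\,|Y-T_k(H)|\le \varepsilon\, T_k(H)\,\big]\ \ge\ 1-\delta ,$$ and the number of bits of its working memory is at most $$C\cdot \varepsilon^{-2}\,\log_2(2/\delta)\,(\log_2 n)^{c}\cdot \frac{m^{2-1/k}}{T},$$ where $C$ and $c$ depend only on $k$. That is, the algorithm $(\varepsilon,\delta)$-approximates $T_k(H)$ in $\widetilde O(m^{2-1/k}/T)$ space under the promise $T_k(H)\ge T$. Here a streaming algorithm is a randomized finite-state machine. It updates its memory as a random function of the pass number, the current memory and the hyperedge just read, and once more at the end of each pass. Random bits that are reused have to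 be kept in memory. The output is a function of the final memory. (2) Moreover, let $\deg(v)$ be the number of hyperedges containing $v$. Call a set $F$ of hyperedges a hyperforest if every non-empty $X\subseteq F$ covers more than $|X|$ vertices, and let the hyperarboricity $\rho(H)$ be the least number of hyperforests into which $E$ can be partitioned. Then there is a constant $C'$ depending only on $k$ such that every $k$-uniform hypergraph $H$ with $m$ hyperedges satisfies $$\sum_{e\in E}\min_{v\in e}\deg(v)\ \le\ k\,m\,\rho(H)\ \le\ C'\,m^{2-1/k}.$$ -/

import Mathlib

/-- A `k`-uniform hypergraph (a `k`-graph) on the vertex set `V`: a finite set of hyperedges,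
each of which is a `k`-element set of vertices. -/
structure KGraph (V : Type) (k : ℕ) where
  edges : Finset (Finset V)
  uniform : ∀ e ∈ edges, e.card = k

namespace KGraph

variable {V : Type} {k : ℕ}

/-- The codegree of `S`: the number of hyperedges that strictly extend `S`. -/
def codeg [DecidableEq V] (H : KGraph V k) (S : Finset V) : ℕ :=
  (H.edges.filter (fun e => S ⊂ e)).card

/-- The degree of a vertex is the codegree of the corresponding singleton. -/
def deg [DecidableEq V] (H : KGraph V k) (v : V) : ℕ := H.codeg {v}

/-- The minimum degree among the vertices of the (non-empty) set `e`. -/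
noncomputable def minDeg [DecidableEq V] (H : KGraph V k) (e : Finset V) : ℕ :=
  sInf (H.deg '' (e : Set V))

/-- The vertex sets of the `k`-simplices in `H`: the sets `X` of `k + 1` vertices such that all
`k`-element subsets of `X` are hyperedges. -/
def simplices [Fintype V] [DecidableEq V] (H : KGraph V k) : Finset (Finset V) :=
  (Finset.univ.powersetCard (k + 1)).filter (fun X => X.powersetCard k ⊆ H.edges)

/-- `T_k(H)`, the number of `k`-simplices in `H`. -/
def numSimplices [Fintype V] [DecidableEq V] (H : KGraph V k) : ℕ := H.simplices.card

/-- `σ` is an edge stream of `H`: it lists every hyperedge exactly once, in arbitrary order. -/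
def IsStream (H : KGraph V k) (σ : List (Finset V)) : Prop :=
  σ.Nodup ∧ ∀ e, e ∈ σ ↔ e ∈ H.edges

end KGraph

/-- A set of hyperedges forms a hyperforest if it has the strong Hall property: every non-empty
subset `X` covers strictly more than `X.card` vertices. -/
def IsHyperforest {V : Type} [DecidableEq V] (F : Finset (Finset V)) : Prop :=
  ∀ X ⊆ F, X.Nonempty → X.card < (X.biUnion id).card

/-- The hyperarboricity of `H`: the least `r` such that the hyperedges of `H` can be coloured
with `r` colours so that every colour class is a hyperforest. -/
noncomputable def KGraph.hyperarboricity {V : Type} [DecidableEq V] {k : ℕ} (H : KGraph V k) : ℕ :=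
  sInf {r : ℕ | ∃ c : Finset V → ℕ, (∀ e ∈ H.edges, c e < r) ∧
    ∀ i < r, IsHyperforest (H.edges.filter (fun e => c e = i))}

/-- A randomized `p`-pass streaming algorithm over streams of items of type `α`.
`State` is the finite set of configurations of the working memory. Whenever an item is read, the
memory is updated by a random transition that sees only the pass number, the current memory and
the current item; all coin tosses are fresh, so random bits that are to be used again have to be
kept in memory. At the end of each pass there is one more (possibly random) update. The answer
is a function of the final memory. -/
structure StreamAlgorithm (α : Type) (p : ℕ) where
  State : Type
  [fintypeState : Fintype State]
  init : PMF State
  step : Fin p → State → α → PMF State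
  endPass : Fin p → State → PMF State
  output : State → ℝ

namespace StreamAlgorithm

variable {α : Type} {p : ℕ}

attribute [instance] StreamAlgorithm.fintypeState

/-- The space used by the algorithm: the number of bits of its working memory. -/
noncomputable def space (A : StreamAlgorithm α p) : ℕ := Nat.clog 2 (Fintype.card A.State)

/-- The distribution of the memory after pass `i` over the stream `σ`, if the pass is started
with memory distributed as `μ`. -/
noncomputable def runPass (A : StreamAlgorithm α p) (σ : List α) (μ : PMF A.State) (i : Fin p) :
    PMF A.State :=
  (σ.foldl (fun ν a => ν.bind (fun s => A.step i s a)) μ).bind (A.endPass i)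

/-- The distribution of the final memory after the passes `0, 1, …, p - 1` over the stream `σ`. -/
noncomputable def run (A : StreamAlgorithm α p) (σ : List α) : PMF A.State :=
  (List.finRange p).foldl (A.runPass σ) A.init

/-- On the stream `σ`, the output of the algorithm is an `(ε, δ)`-estimate of `Q`: it lies in
`[(1 - ε) Q, (1 + ε) Q]` with probability at least `1 - δ`. -/
def Estimates (A : StreamAlgorithm α p) (σ : List α) (Q ε δ : ℝ) : Prop :=
  ENNReal.ofReal (1 - δ) ≤ (A.run σ).toOuterMeasure {s | |A.output s - Q| ≤ ε * Q}

end StreamAlgorithm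

/-! ### Degrees and hyperarboricity -/

namespace KGraph

variable {V : Type} {k : ℕ}

/-! Call the hyperedge left after deleting a vertex of maximum degree from a simplex its base. If
`e` is a base and `v` has minimum degree in `e`, then `e` carries at most `deg v` simplices
(deleting another vertex of `e` yields distinct hyperedges through `v`), and at most as many as
there are vertices of degree at least `deg v` (the vertex outside `e` is one of them). The degree
sum is `k * m`, so the product of the two bounds is at most `k * m`, and a base carries at most `τ =
√(k * m)` simplices (`card_simplexBase_fiber_sq_le`).

The algorithm samples hyperedges with probability `p`, learns the degrees of their vertices, and
joins each sampled hyperedge with all hyperedges through one of its vertices of minimum degree. The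
unions with `k + 1` vertices are candidates, kept with probability `q`. The last pass tests the
candidates and determines their bases. A simplex is counted only if it and its base are both
sampled, hence with probability exactly `p * q`, no matter how many sampled hyperedges produce it.
For pairwise independent hashing the second moment bound `expect_sq_sample_le`, with `τ` as group
size, lets Chebyshev succeed with `p * q ≈ 128 / (ε² T)` and `p ≈ 128 τ / (ε² T)`, probabilities
being capped at one. The expected number of entries is `p * m` hyperedges and at most `p * q * ∑
minDeg` candidates. Since `τ * m ≤ k * m ^ (2 - 1/k)` for `k ≥ 2`, and by part (2), both are of the
claimed order. The memory is truncated at a constant multiple of this; by Markov, overflow is rare.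
A median of about `log₂ (2/δ)` copies amplifies the success probability.

For part (2), order the vertices by degree, breaking ties, and assign each hyperedge to its smallest
vertex. At most `(k * m) ^ (1 - 1/k)` hyperedges share a vertex, so that many colours make the
smallest vertices distinct within each class. Such a class is a hyperforest, because the largest
covered vertex is nobody's smallest. Conversely, Hall's theorem gives the hyperedges of a
hyperforest distinct representatives, so their minimum degrees sum to at most the degree sum `k *
m`; now add over an optimal colouring. -/

lemma nonempty_of_mem (H : KGraph V k) (hk : 2 ≤ k) {e : Finset V} (he : e ∈ H.edges) :
    e.Nonempty := by
  rw [← Finset.card_pos, H.uniform e he]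
  omega

variable [DecidableEq V]

/-- The codegree counts strict supersets; strictness is automatic here since `k ≥ 2` rules out the
hyperedge `{v}`. -/
lemma deg_eq_card (H : KGraph V k) (hk : 2 ≤ k) (v : V) :
    H.deg v = (H.edges.filter (fun e => v ∈ e)).card := by
  unfold deg codeg
  congr 1
  apply Finset.filter_congr
  intro e he
  constructor
  · intro h
    exact h.1 (Finset.mem_singleton_self v)
  · intro h
    refine Finset.ssubset_iff_subset_ne.2 ⟨Finset.singleton_subset_iff.2 h, ?_⟩
    rintro rfl
    have := H.uniform _ he
    rw [Finset.card_singleton] at this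
    omega

lemma minDeg_le (H : KGraph V k) {e : Finset V} {v : V} (hv : v ∈ e) : H.minDeg e ≤ H.deg v :=
  Nat.sInf_le ⟨v, hv, rfl⟩

lemma minDeg_eq (H : KGraph V k) {e : Finset V} {v : V} (hv : v ∈ e)
    (h : ∀ u ∈ e, H.deg v ≤ H.deg u) : H.minDeg e = H.deg v := by
  apply le_antisymm (H.minDeg_le hv)
  have : (H.deg '' (e : Set V)).Nonempty := ⟨_, v, hv, rfl⟩
  obtain ⟨u, hu, hu'⟩ := Nat.sInf_mem this
  unfold minDeg
  rw [← hu']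
  exact h u hu

lemma sum_deg [Fintype V] (H : KGraph V k) (hk : 2 ≤ k) :
    ∑ v, H.deg v = k * H.edges.card := by
  simp_rw [H.deg_eq_card hk, Finset.card_filter]
  rw [Finset.sum_comm]
  have : ∀ e ∈ H.edges, (∑ v, if v ∈ e then 1 else 0) = k := by
    intro e he
    rw [← Finset.card_filter, Finset.filter_mem_eq_inter, Finset.univ_inter]
    exact H.uniform e he
  rw [Finset.sum_congr rfl this, Finset.sum_const, smul_eq_mul, mul_comm]

/-- Markov's inequality for the degree sum. This trade-off underlies both the bound on simplices per
base and the hyperarboricity bound. -/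
lemma card_heavy_mul_le [Fintype V] (H : KGraph V k) (hk : 2 ≤ k) (d : ℕ) :
    (Finset.univ.filter (fun u => d ≤ H.deg u)).card * d ≤ k * H.edges.card := by
  rw [← H.sum_deg hk]
  refine le_trans ?_ (Finset.sum_le_sum_of_subset (Finset.filter_subset (fun u => d ≤ H.deg u) _))
  rw [← smul_eq_mul]
  apply Finset.card_nsmul_le_sum
  intro u hu
  exact (Finset.mem_filter.1 hu).2

/-- Few hyperedges have a given vertex as a vertex of minimum degree. -/
lemma card_minDeg_fiber_pow_le [Fintype V] (H : KGraph V k) (hk : 2 ≤ k) (v : V) :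
    (H.edges.filter (fun e => v ∈ e ∧ ∀ u ∈ e, H.deg v ≤ H.deg u)).card ^ k ≤
      (k * H.edges.card) ^ (k - 1) := by
  set S := H.edges.filter (fun e => v ∈ e ∧ ∀ u ∈ e, H.deg v ≤ H.deg u) with hS
  set W := Finset.univ.filter (fun u => H.deg v ≤ H.deg u) with hW
  have h1 : S.card ≤ H.deg v := by
    rw [H.deg_eq_card hk]
    apply Finset.card_le_card
    intro e he
    simp only [hS, Finset.mem_filter] at he ⊢
    exact ⟨he.1, he.2.1⟩
  -- A hyperedge in `S` is determined by its `k - 1` other vertices, all of which lie in `W`.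
  have h2 : S.card ≤ W.card ^ (k - 1) := by
    refine le_trans ?_ (Nat.choose_le_pow W.card (k - 1))
    rw [← Finset.card_powersetCard]
    apply Finset.card_le_card_of_injOn (fun e => e.erase v)
    · intro e he
      simp only [hS, Finset.coe_filter, Set.mem_ofPred_eq] at he
      rw [Finset.mem_coe, Finset.mem_powersetCard]
      refine ⟨?_, ?_⟩
      · intro u hu
        simp only [hW, Finset.mem_filter, Finset.mem_univ, true_and]
        exact he.2.2 u (Finset.mem_of_mem_erase hu)
      · rw [Finset.card_erase_of_mem he.2.1, H.uniform e he.1]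
    · intro e he f hf hef
      simp only [hS, Finset.coe_filter, Set.mem_ofPred_eq] at he hf
      have := congrArg (insert v) hef
      simpa [Finset.insert_erase he.2.1, Finset.insert_erase hf.2.1] using this
  have h3 := H.card_heavy_mul_le hk (H.deg v)
  -- Using the degree bound `k - 1` times and the bound by `W` once makes the exponents match, so
  -- that `card_heavy_mul_le` applies to the product.
  calc S.card ^ k = S.card ^ (k - 1) * S.card := by
        rw [← pow_succ]; congr 1; omega
    _ ≤ H.deg v ^ (k - 1) * W.card ^ (k - 1) := by gcongr
    _ = (W.card * H.deg v) ^ (k - 1) := by rw [← mul_pow, mul_comm]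
    _ ≤ _ := by gcongr

end KGraph

lemma le_rpow_of_pow_le {c M k : ℕ} (hk : 2 ≤ k) (h : c ^ k ≤ M ^ (k - 1)) :
    (c : ℝ) ≤ (M : ℝ) ^ (1 - 1 / (k : ℝ)) := by
  have hk0 : (0 : ℝ) < k := by positivity
  have h' : (c : ℝ) ^ k ≤ (M : ℝ) ^ (k - 1) := by exact_mod_cast h
  have h2 : (M : ℝ) ^ (k - 1) = ((M : ℝ) ^ (1 - 1 / (k : ℝ))) ^ k := by
    rw [← Real.rpow_natCast _ k, ← Real.rpow_mul (by positivity), ← Real.rpow_natCast]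
    congr 1
    rw [Nat.cast_sub (by omega)]
    field_simp
    simp
  rw [h2] at h'
  exact le_of_pow_le_pow_left₀ (by omega) (by positivity) h'

/-- Hyperedges with pairwise distinct strict minima with respect to some linear order form a
hyperforest. -/
lemma isHyperforest_of_injOn_min {V L : Type} [DecidableEq V] [LinearOrder L] (key : V → L)
    (φ : Finset V → V) (F : Finset (Finset V)) (hcard : ∀ e ∈ F, 2 ≤ e.card)
    (hmem : ∀ e ∈ F, φ e ∈ e) (hkey : Function.Injective key)
    (hmin : ∀ e ∈ F, ∀ u ∈ e, key (φ e) ≤ key u) (hinj : Set.InjOn φ F) : IsHyperforest F := by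
  intro X hX hne
  have hU : (X.biUnion id).Nonempty := by
    obtain ⟨e, he⟩ := hne
    exact ⟨φ e, Finset.mem_biUnion.2 ⟨e, he, hmem e (hX he)⟩⟩
  -- The largest covered vertex is the extra vertex: being the minimum of a hyperedge with two
  -- vertices would contradict maximality.
  obtain ⟨w, hw, hwmax⟩ := Finset.exists_max_image _ key hU
  have hwφ : w ∉ X.image φ := by
    rw [Finset.mem_image]
    rintro ⟨e, he, rfl⟩
    obtain ⟨u, hu, hne⟩ := Finset.exists_mem_ne (s := e) (by have := hcard e (hX he); omega) (φ e)
    have h1 := hmin e (hX he) u hu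
    have h2 := hwmax u (Finset.mem_biUnion.2 ⟨e, he, hu⟩)
    exact hne (hkey (le_antisymm h2 h1))
  have hcardX : (X.image φ).card = X.card :=
    Finset.card_image_of_injOn (hinj.mono (by exact_mod_cast hX))
  have hsub : insert w (X.image φ) ⊆ X.biUnion id := by
    intro u hu
    rcases Finset.mem_insert.1 hu with rfl | hu
    · exact hw
    · obtain ⟨e, he, rfl⟩ := Finset.mem_image.1 hu
      exact Finset.mem_biUnion.2 ⟨e, he, hmem e (hX he)⟩
  have := Finset.card_le_card hsub
  rw [Finset.card_insert_of_notMem hwφ, hcardX] at this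
  omega

/-- A finite set whose fibres under `φ` have at most `r` elements can be coloured with `r` colours
such that `φ` is injective on every colour class. -/
lemma exists_coloring_injOn {α β : Type} [DecidableEq α] [DecidableEq β] (S : Finset α)
    (φ : α → β) (r : ℕ) (h : ∀ b, (S.filter (fun a => φ a = b)).card ≤ r) :
    ∃ c : α → ℕ, (∀ a ∈ S, c a < r) ∧
      ∀ i, Set.InjOn φ (S.filter (fun a => c a = i) : Finset α) := by
  let fib : β → Finset α := fun b => S.filter (fun a => φ a = b)
  have hmem : ∀ a ∈ S, a ∈ fib (φ a) := fun a ha => Finset.mem_filter.2 ⟨ha, rfl⟩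
  have key : ∀ b, ∃ c : α → ℕ, (∀ a ∈ fib b, c a < r) ∧ Set.InjOn c (fib b) := by
    intro b
    refine ⟨fun a => if ha : a ∈ fib b then ((fib b).equivFin ⟨a, ha⟩ : ℕ) else 0, ?_, ?_⟩
    · intro a ha
      simp only [ha, dif_pos]
      exact lt_of_lt_of_le (Fin.is_lt _) (h b)
    · intro a ha a' ha' haa
      rw [Finset.mem_coe] at ha ha'
      simp only [ha, ha', dif_pos] at haa
      have := (fib b).equivFin.injective (Fin.ext haa)
      simpa using this
  choose c hc hcinj using key
  refine ⟨fun a => c (φ a) a, fun a ha => hc _ _ (hmem a ha), ?_⟩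
  intro i a ha a' ha' haa
  simp only [Finset.coe_filter, Set.mem_ofPred_eq] at ha ha'
  refine hcinj (φ a) (hmem a ha.1) ?_ ?_
  · have := hmem a' ha'.1
    rw [← haa] at this
    exact this
  · rw [ha.2, ← ha'.2, haa]

namespace KGraph

lemma exists_hyperforest_coloring {n k : ℕ} (H : KGraph (Fin n) k) (hk : 2 ≤ k) :
    ∃ r : ℕ, (r : ℝ) ≤ ((k * H.edges.card : ℕ) : ℝ) ^ (1 - 1 / (k : ℝ)) ∧
      ∃ c : Finset (Fin n) → ℕ, (∀ e ∈ H.edges, c e < r) ∧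
        ∀ i < r, IsHyperforest (H.edges.filter (fun e => c e = i)) := by
  rcases H.edges.eq_empty_or_nonempty with hE | ⟨e₀, he₀⟩
  · exact ⟨0, by simp only [Nat.cast_zero]; positivity, fun _ => 0, by simp [hE], by simp⟩
  -- Ties between degrees are broken by the vertex itself, which makes the key injective.
  let key : Fin n → ℕ ×ₗ Fin n := fun v => toLex (H.deg v, v)
  have hkey : Function.Injective key := by
    intro u v huv
    have := congrArg (fun x => (ofLex x).2) huv
    simpa [key] using this
  have hdeg : ∀ u v, key u ≤ key v → H.deg u ≤ H.deg v := by
    intro u v huv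
    rw [Prod.Lex.le_iff] at huv
    rcases huv with h | h
    · exact h.le
    · exact h.1.le
  have hex : ∀ e : Finset (Fin n), ∃ v : Fin n, e ∈ H.edges → v ∈ e ∧ ∀ u ∈ e, key v ≤ key u := by
    intro e
    by_cases he : e ∈ H.edges
    · obtain ⟨v, hv, hmin⟩ := Finset.exists_min_image e key (H.nonempty_of_mem hk he)
      exact ⟨v, fun _ => ⟨hv, hmin⟩⟩
    · obtain ⟨v, -⟩ := H.nonempty_of_mem hk he₀
      exact ⟨v, fun h => absurd h he⟩
  choose φ hφ using hex
  set B : ℝ := ((k * H.edges.card : ℕ) : ℝ) ^ (1 - 1 / (k : ℝ)) with hB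
  have hfib : ∀ v, (H.edges.filter (fun e => φ e = v)).card ≤ ⌊B⌋₊ := by
    intro v
    apply Nat.le_floor
    apply le_rpow_of_pow_le hk
    refine le_trans ?_ (H.card_minDeg_fiber_pow_le hk v)
    gcongr 1
    apply Finset.card_le_card
    intro e he
    simp only [Finset.mem_filter] at he ⊢
    obtain ⟨he, rfl⟩ := he
    exact ⟨he, (hφ e he).1, fun u hu => hdeg _ _ ((hφ e he).2 u hu)⟩
  obtain ⟨c, hc, hinj⟩ := exists_coloring_injOn H.edges φ _ hfib
  refine ⟨⌊B⌋₊, Nat.floor_le (by positivity), c, hc, fun i _ => ?_⟩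
  have hsub : ∀ e ∈ H.edges.filter (fun e => c e = i), e ∈ H.edges :=
    fun e he => (Finset.mem_filter.1 he).1
  refine isHyperforest_of_injOn_min key φ _ ?_ ?_ hkey ?_ (hinj i)
  · intro e he
    rw [H.uniform e (hsub e he)]
    exact hk
  · exact fun e he => (hφ e (hsub e he)).1
  · exact fun e he => (hφ e (hsub e he)).2

lemma hyperarboricity_le {n k : ℕ} (H : KGraph (Fin n) k) (hk : 2 ≤ k) :
    (H.hyperarboricity : ℝ) ≤ ((k * H.edges.card : ℕ) : ℝ) ^ (1 - 1 / (k : ℝ)) := by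
  obtain ⟨r, hr, h⟩ := H.exists_hyperforest_coloring hk
  refine le_trans ?_ hr
  exact_mod_cast Nat.sInf_le h

/-- A hyperforest satisfies Hall's condition, so its hyperedges have distinct representatives; each
minimum degree is at most the degree of the representative. -/
lemma sum_minDeg_hyperforest_le {V : Type} [Fintype V] [DecidableEq V] {k : ℕ} (H : KGraph V k)
    (hk : 2 ≤ k) (F : Finset (Finset V)) (hF : IsHyperforest F) :
    ∑ e ∈ F, H.minDeg e ≤ k * H.edges.card := by
  have hall : ∀ s : Finset F, s.card ≤ (s.biUnion (fun e => (e : Finset V))).card := by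
    intro s
    rcases s.eq_empty_or_nonempty with rfl | hs
    · simp
    have := hF (s.map (Function.Embedding.subtype _)) (by
      intro e he
      obtain ⟨x, -, rfl⟩ := Finset.mem_map.1 he
      exact x.2) (hs.map)
    rw [Finset.card_map, Finset.map_eq_image, Finset.image_biUnion] at this
    exact this.le
  obtain ⟨f, hf, hfm⟩ := (Finset.all_card_le_biUnion_card_iff_exists_injective _).1 hall
  rw [← H.sum_deg hk, ← Finset.sum_coe_sort]
  calc ∑ e : F, H.minDeg e ≤ ∑ e : F, H.deg (f e) :=
        Finset.sum_le_sum fun e _ => H.minDeg_le (hfm e)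
    _ = ∑ v ∈ Finset.univ.map ⟨f, hf⟩, H.deg v := by rw [Finset.sum_map]; rfl
    _ ≤ _ := Finset.sum_le_sum_of_subset (Finset.subset_univ _)

lemma sum_minDeg_le_hyperarboricity {n k : ℕ} (H : KGraph (Fin n) k) (hk : 2 ≤ k) :
    ∑ e ∈ H.edges, H.minDeg e ≤ k * H.edges.card * H.hyperarboricity := by
  have hne : {r : ℕ | ∃ c : Finset (Fin n) → ℕ, (∀ e ∈ H.edges, c e < r) ∧
      ∀ i < r, IsHyperforest (H.edges.filter (fun e => c e = i))}.Nonempty := by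
    obtain ⟨r, -, h⟩ := H.exists_hyperforest_coloring hk
    exact ⟨r, h⟩
  obtain ⟨c, hc, hF⟩ := Nat.sInf_mem hne
  have hmaps : ∀ e ∈ H.edges, c e ∈ Finset.range H.hyperarboricity :=
    fun e he => Finset.mem_range.2 (hc e he)
  rw [← Finset.sum_fiberwise_of_maps_to hmaps]
  refine (Finset.sum_le_card_nsmul _ _ (k * H.edges.card) ?_).trans (le_of_eq ?_)
  · exact fun i hi => H.sum_minDeg_hyperforest_le hk _ (hF i (Finset.mem_range.1 hi))
  · rw [Finset.card_range, smul_eq_mul, mul_comm]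

lemma mul_hyperarboricity_le {n k : ℕ} (H : KGraph (Fin n) k) (hk : 2 ≤ k) :
    (k : ℝ) * (H.edges.card : ℝ) * (H.hyperarboricity : ℝ) ≤
      (k : ℝ) ^ 2 * (H.edges.card : ℝ) ^ (2 - 1 / (k : ℝ)) := by
  rcases Nat.eq_zero_or_pos H.edges.card with h0 | hpos
  · rw [h0]
    simp only [Nat.cast_zero, mul_zero, zero_mul]
    positivity
  have hk1 : (1 : ℝ) ≤ k := by exact_mod_cast (by omega : 1 ≤ k)
  have hm : (0 : ℝ) < H.edges.card := by exact_mod_cast hpos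
  have hkk : (k : ℝ) ^ (1 - 1 / (k : ℝ)) ≤ k := by
    conv_rhs => rw [← Real.rpow_one (k : ℝ)]
    apply Real.rpow_le_rpow_of_exponent_le hk1
    have : 0 ≤ 1 / (k : ℝ) := by positivity
    linarith
  have h := H.hyperarboricity_le hk
  rw [Nat.cast_mul, Real.mul_rpow (by positivity) (by positivity)] at h
  have hsplit : (H.edges.card : ℝ) ^ (2 - 1 / (k : ℝ)) =
      H.edges.card * (H.edges.card : ℝ) ^ (1 - 1 / (k : ℝ)) := by
    rw [← Real.rpow_one_add' (by positivity)]
    · congr 1; ring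
    · have : 1 / (k : ℝ) ≤ 1 := by
        rw [div_le_one (by positivity)]; exact hk1
      linarith
  rw [hsplit]
  calc (k : ℝ) * (H.edges.card : ℝ) * (H.hyperarboricity : ℝ)
      ≤ k * H.edges.card * (k * (H.edges.card : ℝ) ^ (1 - 1 / (k : ℝ))) := by
        gcongr
        refine h.trans ?_
        gcongr
    _ = _ := by ring

end KGraph

/-! ### Vertices of minimum and maximum degree, and the base of a simplex -/

section Extremal

variable {V : Type}

/-- A singleton contained in `S`, if `S` is non-empty. -/
noncomputable def pickOne (S : Finset V) : Finset V :=
  open Classical in if h : S.Nonempty then {h.choose} else ∅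

lemma pickOne_spec {S : Finset V} (h : S.Nonempty) : ∃ v ∈ S, pickOne S = {v} :=
  ⟨h.choose, h.choose_spec, by unfold pickOne; rw [dif_pos h]⟩

/-- A vertex of `e` at which `d` is minimal, as a singleton. -/
noncomputable def lowVertex (d : V → ℕ) (e : Finset V) : Finset V :=
  open Classical in pickOne (e.filter (fun v => ∀ u ∈ e, d v ≤ d u))

/-- A vertex of `e` at which `d` is maximal, as a singleton. -/
noncomputable def highVertex (d : V → ℕ) (e : Finset V) : Finset V :=
  open Classical in pickOne (e.filter (fun v => ∀ u ∈ e, d u ≤ d v))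

lemma lowVertex_spec (d : V → ℕ) {e : Finset V} (h : e.Nonempty) :
    ∃ v ∈ e, (∀ u ∈ e, d v ≤ d u) ∧ lowVertex d e = {v} := by
  classical
  obtain ⟨w, hw, hmin⟩ := Finset.exists_min_image e d h
  obtain ⟨v, hv, hv'⟩ := pickOne_spec (S := e.filter (fun v => ∀ u ∈ e, d v ≤ d u))
    ⟨w, Finset.mem_filter.2 ⟨hw, hmin⟩⟩
  rw [Finset.mem_filter] at hv
  refine ⟨v, hv.1, hv.2, ?_⟩
  rw [← hv']
  unfold lowVertex
  congr!

lemma highVertex_spec (d : V → ℕ) {e : Finset V} (h : e.Nonempty) :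
    ∃ v ∈ e, (∀ u ∈ e, d u ≤ d v) ∧ highVertex d e = {v} := by
  classical
  obtain ⟨w, hw, hmax⟩ := Finset.exists_max_image e d h
  obtain ⟨v, hv, hv'⟩ := pickOne_spec (S := e.filter (fun v => ∀ u ∈ e, d u ≤ d v))
    ⟨w, Finset.mem_filter.2 ⟨hw, hmax⟩⟩
  rw [Finset.mem_filter] at hv
  refine ⟨v, hv.1, hv.2, ?_⟩
  rw [← hv']
  unfold highVertex
  congr!

/-- The choice depends only on degrees inside `e`, so an algorithm that tracks only these degrees
makes the same choice. -/
lemma lowVertex_congr {d d' : V → ℕ} {e : Finset V} (h : ∀ v ∈ e, d v = d' v) :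
    lowVertex d e = lowVertex d' e := by
  unfold lowVertex
  congr 1
  apply Finset.filter_congr
  intro v hv
  apply forall₂_congr
  intro u hu
  rw [h v hv, h u hu]

lemma highVertex_congr {d d' : V → ℕ} {e : Finset V} (h : ∀ v ∈ e, d v = d' v) :
    highVertex d e = highVertex d' e := by
  unfold highVertex
  congr 1
  apply Finset.filter_congr
  intro v hv
  apply forall₂_congr
  intro u hu
  rw [h v hv, h u hu]

variable [DecidableEq V]

/-- The hyperedge that is obtained from a simplex by removing a vertex of maximum degree. -/
noncomputable def simplexBase (d : V → ℕ) (X : Finset V) : Finset V := X \ highVertex d X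

lemma simplexBase_congr {d d' : V → ℕ} {X : Finset V} (h : ∀ v ∈ X, d v = d' v) :
    simplexBase d X = simplexBase d' X := by
  unfold simplexBase
  rw [highVertex_congr h]

lemma simplexBase_spec (d : V → ℕ) {X : Finset V} (h : X.Nonempty) :
    ∃ w ∈ X, (∀ u ∈ X, d u ≤ d w) ∧ simplexBase d X = X.erase w := by
  obtain ⟨w, hw, hmax, hw'⟩ := highVertex_spec d h
  refine ⟨w, hw, hmax, ?_⟩
  unfold simplexBase
  rw [hw', Finset.sdiff_singleton_eq_erase]

end Extremal

/-! ### Candidates, and the number of simplices per base -/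

namespace KGraph

variable {V : Type} [DecidableEq V] {k : ℕ}

/-- The sets of `k + 1` vertices that are the union of `e` and a hyperedge which contains a given
vertex of `e` of minimum degree. -/
noncomputable def candidates (H : KGraph V k) (e : Finset V) : Finset (Finset V) :=
  ((H.edges.filter (fun f => lowVertex H.deg e ⊆ f)).image (fun f => e ∪ f)).filter
    (fun X => X.card = k + 1)

lemma card_candidates_le (H : KGraph V k) (hk : 2 ≤ k) {e : Finset V} (he : e ∈ H.edges) :
    (H.candidates e).card ≤ H.minDeg e := by
  obtain ⟨v, hv, hmin, hlow⟩ := lowVertex_spec H.deg (H.nonempty_of_mem hk he)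
  refine (Finset.card_filter_le _ _).trans (Finset.card_image_le.trans ?_)
  rw [H.minDeg_eq hv hmin, H.deg_eq_card hk, hlow]
  simp_rw [Finset.singleton_subset_iff]
  exact le_rfl

variable [Fintype V]

lemma mem_simplices (H : KGraph V k) {X : Finset V} :
    X ∈ H.simplices ↔ X.card = k + 1 ∧ X.powersetCard k ⊆ H.edges := by
  unfold simplices
  rw [Finset.mem_filter, Finset.mem_powersetCard]
  simp

lemma erase_mem_edges (H : KGraph V k) {X : Finset V} (hX : X ∈ H.simplices) {w : V}
    (hw : w ∈ X) : X.erase w ∈ H.edges := by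
  rw [mem_simplices] at hX
  apply hX.2
  rw [Finset.mem_powersetCard]
  refine ⟨Finset.erase_subset _ _, ?_⟩
  rw [Finset.card_erase_of_mem hw, hX.1]
  rfl

lemma simplex_nonempty (H : KGraph V k) {X : Finset V} (hX : X ∈ H.simplices) : X.Nonempty := by
  rw [← Finset.card_pos, (H.mem_simplices.1 hX).1]
  omega

lemma simplexBase_mem (H : KGraph V k) {X : Finset V} (hX : X ∈ H.simplices) (d : V → ℕ) :
    simplexBase d X ∈ H.edges := by
  obtain ⟨w, hw, -, h⟩ := simplexBase_spec d (H.simplex_nonempty hX)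
  rw [h]
  exact H.erase_mem_edges hX hw

/-- Let `v` be the chosen low vertex of the base and `u` another vertex of the base. Then `X.erase
u` is a hyperedge through `v`, and its union with the base is `X`. Hence sampling the base suffices
to discover `X`. -/
lemma mem_candidates_simplexBase (H : KGraph V k) (hk : 2 ≤ k) {X : Finset V}
    (hX : X ∈ H.simplices) (d : V → ℕ) : X ∈ H.candidates (simplexBase d X) := by
  have he := H.simplexBase_mem hX d
  obtain ⟨w, hw, -, hbase⟩ := simplexBase_spec d (H.simplex_nonempty hX)
  obtain ⟨v, hv, -, hlow⟩ := lowVertex_spec H.deg (H.nonempty_of_mem hk he)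
  obtain ⟨u, hu, huv⟩ := Finset.exists_mem_ne
    (s := simplexBase d X) (by rw [H.uniform _ he]; omega) v
  have hbX : simplexBase d X ⊆ X := Finset.sdiff_subset
  refine Finset.mem_filter.2 ⟨Finset.mem_image.2 ⟨X.erase u, Finset.mem_filter.2
    ⟨H.erase_mem_edges hX (hbX hu), ?_⟩, ?_⟩, (H.mem_simplices.1 hX).1⟩
  · rw [hlow, Finset.singleton_subset_iff, Finset.mem_erase]
    exact ⟨huv.symm, hbX hv⟩
  · apply Finset.Subset.antisymm (Finset.union_subset hbX (Finset.erase_subset _ _))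
    intro x hx
    by_cases hxu : x = u
    · subst hxu
      exact Finset.mem_union_left _ hu
    · exact Finset.mem_union_right _ (Finset.mem_erase.2 ⟨hxu, hx⟩)

/-- Few simplices have the same base. -/
lemma card_simplexBase_fiber_sq_le (H : KGraph V k) (hk : 2 ≤ k) (e : Finset V) :
    (H.simplices.filter (fun X => simplexBase H.deg X = e)).card ^ 2 ≤ k * H.edges.card := by
  set S := H.simplices.filter (fun X => simplexBase H.deg X = e) with hS
  rcases S.eq_empty_or_nonempty with h0 | ⟨X₀, hX₀⟩
  · rw [h0]; simp
  have he : e ∈ H.edges := by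
    rw [hS, Finset.mem_filter] at hX₀
    rw [← hX₀.2]
    exact H.simplexBase_mem hX₀.1 _
  obtain ⟨v, hv, hmin, -⟩ := lowVertex_spec H.deg (H.nonempty_of_mem hk he)
  obtain ⟨u, hu, huv⟩ := Finset.exists_mem_ne (s := e) (by rw [H.uniform _ he]; omega) v
  have hX : ∀ X ∈ S, X ∈ H.simplices ∧ ∃ w, w ∈ X ∧ H.deg v ≤ H.deg w ∧ e = X.erase w := by
    intro X hX
    rw [hS, Finset.mem_filter] at hX
    obtain ⟨w, hw, hmax, hb⟩ := simplexBase_spec H.deg (H.simplex_nonempty hX.1)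
    rw [hX.2] at hb
    refine ⟨hX.1, w, hw, ?_, hb⟩
    apply hmax
    rw [hb] at hv
    exact Finset.mem_of_mem_erase hv
  -- All simplices over `e` contain `u`, so erasing it is injective, and what remains is a hyperedge
  -- through `v`.
  have h1 : S.card ≤ H.deg v := by
    rw [H.deg_eq_card hk]
    apply Finset.card_le_card_of_injOn (fun X => X.erase u)
    · intro X hXS
      obtain ⟨hXs, w, hw, -, hb⟩ := hX X hXS
      rw [Finset.mem_coe, Finset.mem_filter]
      refine ⟨H.erase_mem_edges hXs ?_, Finset.mem_erase.2 ⟨huv.symm, ?_⟩⟩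
      · rw [hb] at hu; exact Finset.mem_of_mem_erase hu
      · rw [hb] at hv; exact Finset.mem_of_mem_erase hv
    · intro X hXS Y hYS hXY
      obtain ⟨-, w, -, -, hb⟩ := hX X hXS
      obtain ⟨-, w', -, -, hb'⟩ := hX Y hYS
      have huX : u ∈ X := by rw [hb] at hu; exact Finset.mem_of_mem_erase hu
      have huY : u ∈ Y := by rw [hb'] at hu; exact Finset.mem_of_mem_erase hu
      have := congrArg (insert u) hXY
      simpa [Finset.insert_erase huX, Finset.insert_erase huY] using this
  -- A simplex over `e` is determined by its removed vertex, whose degree is maximal in the simplex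
  -- and hence at least that of `v`.
  have h2 : S.card ≤ (Finset.univ.filter (fun w => H.deg v ≤ H.deg w)).card := by
    refine le_trans (Finset.card_le_card ?_) (Finset.card_image_le (f := fun w => insert w e))
    intro X hXS
    obtain ⟨-, w, hw, hd, hb⟩ := hX X hXS
    refine Finset.mem_image.2 ⟨w, by simpa using hd, ?_⟩
    rw [hb, Finset.insert_erase hw]
  calc S.card ^ 2 = S.card * S.card := sq _
    _ ≤ (Finset.univ.filter (fun w => H.deg v ≤ H.deg w)).card * H.deg v := by gcongr
    _ ≤ _ := H.card_heavy_mul_le hk _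

lemma card_simplexBase_fiber_le (H : KGraph V k) (hk : 2 ≤ k) (e : Finset V) :
    ((H.simplices.filter (fun X => simplexBase H.deg X = e)).card : ℝ) ≤
      √(k * H.edges.card) := by
  apply Real.le_sqrt_of_sq_le
  exact_mod_cast H.card_simplexBase_fiber_sq_le hk e

lemma numSimplices_le (H : KGraph V k) (hk : 2 ≤ k) :
    (H.numSimplices : ℝ) ≤ √(k * H.edges.card) * H.edges.card := by
  unfold numSimplices
  rw [Finset.card_eq_sum_card_fiberwise (f := simplexBase H.deg) (t := H.edges)
    (fun X hX => H.simplexBase_mem hX _)]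
  push_cast
  refine (Finset.sum_le_card_nsmul _ _ _ (fun e _ => H.card_simplexBase_fiber_le hk e)).trans ?_
  rw [nsmul_eq_mul, mul_comm]

end KGraph

/-! ### Second moments and tail bounds -/

open scoped BigOperators in
lemma expect_prod_mul {Ω₁ Ω₂ : Type} [Fintype Ω₁] [Fintype Ω₂] (f : Ω₁ → ℝ) (g : Ω₂ → ℝ) :
    𝔼 w : Ω₁ × Ω₂, f w.1 * g w.2 = (𝔼 w, f w) * 𝔼 w, g w := by
  rw [← Finset.univ_product_univ, Finset.expect_product]
  simp_rw [← Finset.mul_expect]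
  rw [Finset.expect_mul]

open scoped BigOperators in
/-- The second moment of a two-stage sample: the item `x` is sampled if its group `φ x` is sampled
(with probability `p`) and it is sampled itself (with probability `q`), both choices being pairwise
independent. -/
lemma expect_sq_sample_le {Ω₁ Ω₂ X E : Type} [Fintype Ω₁] [Fintype Ω₂] [Nonempty Ω₁] [Nonempty Ω₂]
    [DecidableEq X] [DecidableEq E] (S : Finset X) (φ : X → E) (a : E → Ω₁ → ℝ) (b : X → Ω₂ → ℝ)
    (p q τ : ℝ) (hp0 : 0 ≤ p) (hp1 : p ≤ 1) (hq0 : 0 ≤ q) (hq1 : q ≤ 1)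
    (ha : ∀ x ∈ S, 𝔼 w, a (φ x) w = p) (hb : ∀ x ∈ S, 𝔼 w, b x w = q)
    (ha_idem : ∀ e w, a e w * a e w = a e w) (hb_idem : ∀ x w, b x w * b x w = b x w)
    (ha2 : ∀ x ∈ S, ∀ y ∈ S, φ x ≠ φ y → 𝔼 w, a (φ x) w * a (φ y) w = p * p)
    (hb2 : ∀ x ∈ S, ∀ y ∈ S, x ≠ y → 𝔼 w, b x w * b y w = q * q)
    (hτ : ∀ e, ((S.filter (fun x => φ x = e)).card : ℝ) ≤ τ) :
    𝔼 w : Ω₁ × Ω₂, (∑ x ∈ S, a (φ x) w.1 * b x w.2 - p * q * S.card) ^ 2 ≤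
      S.card * (p * q * (1 - p * q) + p * (1 - p) * q ^ 2 * τ) := by
  have hmean : 𝔼 w : Ω₁ × Ω₂, ∑ x ∈ S, a (φ x) w.1 * b x w.2 = p * q * S.card := by
    rw [Finset.expect_sum_comm, Finset.sum_congr rfl (g := fun _ => p * q)]
    · rw [Finset.sum_const, nsmul_eq_mul, mul_comm]
    · intro x hx
      rw [expect_prod_mul, ha x hx, hb x hx]
  have hsq : 𝔼 w : Ω₁ × Ω₂, (∑ x ∈ S, a (φ x) w.1 * b x w.2 - p * q * S.card) ^ 2 =
      𝔼 w : Ω₁ × Ω₂, (∑ x ∈ S, a (φ x) w.1 * b x w.2) ^ 2 - (p * q * S.card) ^ 2 := by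
    have : ∀ w : Ω₁ × Ω₂, (∑ x ∈ S, a (φ x) w.1 * b x w.2 - p * q * S.card) ^ 2 =
        (∑ x ∈ S, a (φ x) w.1 * b x w.2) ^ 2
          - 2 * (p * q * S.card) * (∑ x ∈ S, a (φ x) w.1 * b x w.2) + (p * q * S.card) ^ 2 := by
      intro w; ring
    simp_rw [this]
    rw [Finset.expect_add_distrib, Finset.expect_sub_distrib, ← Finset.mul_expect, hmean,
      Fintype.expect_const]
    ring
  have hpq : p * q ≤ 1 := mul_le_one₀ hp1 hq0 hq1
  -- Only pairs with `x = y` or in a common group exceed the product of the means. The factors `1 -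
  -- p * q` and `1 - p` are retained because they must vanish when a probability is capped at one.
  have hterm : ∀ x ∈ S, ∀ y ∈ S,
      𝔼 w : Ω₁ × Ω₂, (a (φ x) w.1 * b x w.2) * (a (φ y) w.1 * b y w.2) ≤
      p * q * (p * q) + ((if x = y then p * q * (1 - p * q) else 0) +
        (if φ y = φ x then p * (1 - p) * q ^ 2 else 0)) := by
    intro x hx y hy
    have hre : ∀ w : Ω₁ × Ω₂, (a (φ x) w.1 * b x w.2) * (a (φ y) w.1 * b y w.2) =
        (a (φ x) w.1 * a (φ y) w.1) * (b x w.2 * b y w.2) := by intro w; ring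
    simp_rw [hre]
    rw [expect_prod_mul (fun w => a (φ x) w * a (φ y) w) (fun w => b x w * b y w)]
    have hnn : 0 ≤ p * (1 - p) * q ^ 2 := by
      have : 0 ≤ 1 - p := by linarith
      positivity
    by_cases hxy : x = y
    · subst hxy
      simp only [if_true, ha_idem, hb_idem, ha x hx, hb x hx]
      nlinarith
    · rw [hb2 x hx y hy hxy, if_neg hxy]
      by_cases hφ : φ x = φ y
      · rw [hφ, if_pos rfl]
        simp only [ha_idem, ha y hy]
        nlinarith
      · rw [ha2 x hx y hy hφ, if_neg (Ne.symm hφ)]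
        nlinarith
  rw [hsq]
  have hexp : 𝔼 w : Ω₁ × Ω₂, (∑ x ∈ S, a (φ x) w.1 * b x w.2) ^ 2 =
      ∑ x ∈ S, ∑ y ∈ S, 𝔼 w : Ω₁ × Ω₂, (a (φ x) w.1 * b x w.2) * (a (φ y) w.1 * b y w.2) := by
    simp_rw [sq, Finset.sum_mul_sum]
    rw [Finset.expect_sum_comm]
    exact Finset.sum_congr rfl fun x _ => Finset.expect_sum_comm _ _ _
  rw [hexp]
  have hnn : 0 ≤ p * (1 - p) * q ^ 2 := by
    have : 0 ≤ 1 - p := by linarith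
    positivity
  have hrow : ∀ x ∈ S,
      ∑ y ∈ S, 𝔼 w : Ω₁ × Ω₂, (a (φ x) w.1 * b x w.2) * (a (φ y) w.1 * b y w.2) ≤
      S.card * (p * q * (p * q)) + (p * q * (1 - p * q) + p * (1 - p) * q ^ 2 * τ) := by
    intro x hx
    refine (Finset.sum_le_sum (hterm x hx)).trans ?_
    rw [Finset.sum_add_distrib, Finset.sum_add_distrib, Finset.sum_const, nsmul_eq_mul,
      Finset.sum_ite_eq, if_pos hx, ← Finset.sum_filter, Finset.sum_const, nsmul_eq_mul,
      mul_comm (p * (1 - p) * q ^ 2) τ]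
    gcongr
    exact hτ (φ x)
  have := Finset.sum_le_sum hrow
  rw [Finset.sum_const, nsmul_eq_mul] at this
  nlinarith

/-- Markov's inequality for the uniform distribution. -/
lemma card_lt_mul_le_sum {Ω : Type} [Fintype Ω] (f : Ω → ℝ) (hf : ∀ w, 0 ≤ f w) (c : ℝ)
    [DecidablePred fun w => c < f w] :
    ((Finset.univ.filter (fun w => c < f w)).card : ℝ) * c ≤ ∑ w, f w := by
  calc ((Finset.univ.filter (fun w => c < f w)).card : ℝ) * c
      ≤ ∑ w ∈ Finset.univ.filter (fun w => c < f w), f w := by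
        rw [← nsmul_eq_mul]
        exact Finset.card_nsmul_le_sum _ _ _ fun w hw => (Finset.mem_filter.1 hw).2.le
    _ ≤ _ := Finset.sum_le_sum_of_subset_of_nonneg (Finset.filter_subset _ _) fun w _ _ => hf w

open scoped BigOperators in
lemma card_lt_le_of_expect_le {Ω : Type} [Fintype Ω] [Nonempty Ω] (f : Ω → ℝ) (hf : ∀ w, 0 ≤ f w)
    (c : ℝ) (hc : 0 < c) [DecidablePred fun w => c < f w] (h : 𝔼 w, f w ≤ c / 64) :
    ((Finset.univ.filter (fun w => c < f w)).card : ℝ) ≤ Fintype.card Ω / 64 := by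
  have h1 := card_lt_mul_le_sum f hf c
  rw [Fintype.expect_eq_sum_div_card, div_le_iff₀ (by positivity)] at h
  have h2 := h1.trans h
  have : c / 64 * Fintype.card Ω = (Fintype.card Ω / 64 : ℝ) * c := by ring
  rw [this] at h2
  exact le_of_mul_le_mul_right h2 hc

/-- If an event has probability at most `1 / 16`, then it rarely occurs in half of `r` independent
trials. -/
lemma card_majority_bad_le {Ω : Type} [Fintype Ω] [DecidableEq Ω] (bad : Finset Ω)
    (hbad : (bad.card : ℝ) ≤ Fintype.card Ω / 16) (r : ℕ) :
    ((Finset.univ.filter (fun w : Fin r → Ω =>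
        r ≤ 2 * (Finset.univ.filter (fun i => w i ∈ bad)).card)).card : ℝ) ≤
      (Fintype.card Ω : ℝ) ^ r / 2 ^ r := by
  -- Exponential moment: each trial contributes a mean factor of at most `15/16 + 1 ≤ 2`, while the
  -- event forces `f ≥ 16 ^ (r/2) = 4 ^ r`.
  set f : (Fin r → Ω) → ℝ := fun w => ∏ i, (if w i ∈ bad then (16 : ℝ) else 1) with hf
  have hfval : ∀ w, f w = 16 ^ (Finset.univ.filter (fun i => w i ∈ bad)).card := by
    intro w
    rw [hf]
    simp [Finset.prod_ite]
  have hsum : ∑ w, f w ≤ (2 * Fintype.card Ω : ℝ) ^ r := by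
    have h1 : ∑ w, f w = ∏ _i : Fin r, ∑ x : Ω, (if x ∈ bad then (16 : ℝ) else 1) := by
      rw [Finset.prod_univ_sum, Fintype.piFinset_univ]
    rw [h1, Finset.prod_const, Finset.card_univ, Fintype.card_fin]
    have h2 : ∑ x : Ω, (if x ∈ bad then (16 : ℝ) else 1) = 15 * bad.card + Fintype.card Ω := by
      have : ∀ x : Ω, (if x ∈ bad then (16 : ℝ) else 1) = (if x ∈ bad then 15 else 0) + 1 := by
        intro x; split_ifs <;> norm_num
      simp_rw [this]
      rw [Finset.sum_add_distrib, ← Finset.sum_filter]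
      simp [mul_comm]
    rw [h2]
    gcongr
    linarith [(Nat.cast_nonneg (Fintype.card Ω) : (0 : ℝ) ≤ _)]
  have hle : ∀ w ∈ Finset.univ.filter (fun w : Fin r → Ω =>
      r ≤ 2 * (Finset.univ.filter (fun i => w i ∈ bad)).card), (4 : ℝ) ^ r ≤ f w := by
    intro w hw
    rw [hfval, show (16 : ℝ) = 4 ^ 2 by norm_num, ← pow_mul]
    exact pow_le_pow_right₀ (by norm_num) (Finset.mem_filter.1 hw).2
  have h3 := Finset.card_nsmul_le_sum _ _ _ hle
  rw [nsmul_eq_mul] at h3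
  have h4 := h3.trans ((Finset.sum_le_sum_of_subset_of_nonneg (Finset.subset_univ _)
    (fun w _ _ => show 0 ≤ f w by rw [hfval]; positivity)).trans hsum)
  rw [le_div_iff₀ (by positivity)]
  have h5 : (4 : ℝ) ^ r = 2 ^ r * 2 ^ r := by rw [← mul_pow]; norm_num
  rw [h5, mul_pow] at h4
  have h6 : (0 : ℝ) < 2 ^ r := by positivity
  nlinarith

/-! ### Medians -/

/-- The (upper) median of finitely many real numbers. -/
noncomputable def upperMedian {r : ℕ} (Y : Fin r → ℝ) : ℝ :=
  sInf {y : ℝ | r < 2 * (Finset.univ.filter (fun i => Y i ≤ y)).card}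

/-- Two strict majorities of indices intersect, so any `y` that bounds a majority from above is at
least some value in the interval. -/
lemma upperMedian_mem_Icc {r : ℕ} (Y : Fin r → ℝ) (a b : ℝ)
    (h : r < 2 * (Finset.univ.filter (fun i => Y i ∈ Set.Icc a b)).card) :
    upperMedian Y ∈ Set.Icc a b := by
  have hb : b ∈ {y : ℝ | r < 2 * (Finset.univ.filter (fun i => Y i ≤ y)).card} := by
    refine lt_of_lt_of_le h ?_
    gcongr with i
    intro hi
    exact hi.2
  have hlow : ∀ y ∈ {y : ℝ | r < 2 * (Finset.univ.filter (fun i => Y i ≤ y)).card}, a ≤ y := by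
    intro y hy
    have hy' : r < 2 * (Finset.univ.filter (fun i => Y i ≤ y)).card := hy
    have hun := Finset.card_union_add_card_inter (Finset.univ.filter (fun i => Y i ≤ y))
      (Finset.univ.filter (fun i => Y i ∈ Set.Icc a b))
    have hle := Finset.card_le_univ ((Finset.univ.filter (fun i => Y i ≤ y)) ∪
      (Finset.univ.filter (fun i => Y i ∈ Set.Icc a b)))
    rw [Fintype.card_fin] at hle
    have : 0 < ((Finset.univ.filter (fun i => Y i ≤ y)) ∩
      (Finset.univ.filter (fun i => Y i ∈ Set.Icc a b))).card := by omega
    obtain ⟨i, hi⟩ := Finset.card_pos.1 this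
    rw [Finset.mem_inter, Finset.mem_filter, Finset.mem_filter] at hi
    exact hi.2.2.1.trans hi.1.2
  exact ⟨le_csInf ⟨b, hb⟩ hlow, csInf_le ⟨a, hlow⟩ hb⟩

/-! ### Pairwise independent sampling -/

section Hash

variable {P : ℕ} [Fact P.Prime]

/-- The indicator of the event that the affine function with coefficients `w` samples `x`. -/
noncomputable def affineInd (s : ℕ) (x : ZMod P) (w : ZMod P × ZMod P) : ℝ :=
  if (w.1 * x + w.2).val < s then 1 else 0

lemma card_val_lt {s : ℕ} (hs : s ≤ P) :
    ∑ z : ZMod P, (if z.val < s then (1 : ℝ) else 0) = s := by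
  rw [← Finset.sum_filter, Finset.sum_const, nsmul_eq_mul, mul_one]
  congr 1
  have : (Finset.univ.filter (fun z : ZMod P => z.val < s)).card = (Finset.range s).card := by
    apply Finset.card_nbij' (fun z : ZMod P => z.val) (fun i : ℕ => (i : ZMod P))
    · intro z hz
      simpa using hz
    · intro i hi
      rw [Finset.mem_coe, Finset.mem_range] at hi
      simp [ZMod.val_natCast, Nat.mod_eq_of_lt (hi.trans_le hs), hi]
    · intro z hz
      simp
    · intro i hi
      rw [Finset.mem_coe, Finset.mem_range] at hi
      simp [ZMod.val_natCast, Nat.mod_eq_of_lt (hi.trans_le hs)]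
  rw [this, Finset.card_range]

open scoped BigOperators in
lemma expect_affineInd {s : ℕ} (hs : s ≤ P) (x : ZMod P) :
    𝔼 w, affineInd s x w = (s : ℝ) / P := by
  have hP : (P : ℝ) ≠ 0 := by exact_mod_cast (Fact.out : P.Prime).ne_zero
  rw [Fintype.expect_eq_sum_div_card, Fintype.card_prod, ZMod.card, Fintype.sum_prod_type]
  have : ∀ a : ZMod P, ∑ b : ZMod P, affineInd s x (a, b) = s := by
    intro a
    unfold affineInd
    rw [← card_val_lt hs]
    exact Fintype.sum_equiv (Equiv.addLeft (a * x)) _ _ (fun b => rfl)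
  simp_rw [this]
  rw [Finset.sum_const, Finset.card_univ, ZMod.card, nsmul_eq_mul]
  push_cast
  field_simp

open scoped BigOperators in
lemma expect_affineInd_mul {s : ℕ} (hs : s ≤ P) {x y : ZMod P} (hxy : x ≠ y) :
    𝔼 w, affineInd s x w * affineInd s y w = (s : ℝ) / P * (s / P) := by
  have hP : (P : ℝ) ≠ 0 := by exact_mod_cast (Fact.out : P.Prime).ne_zero
  have hxy' : x - y ≠ 0 := sub_ne_zero.2 hxy
  let φ : ZMod P × ZMod P → ZMod P × ZMod P := fun w => (w.1 * x + w.2, w.1 * y + w.2)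
  -- An affine function over a field is determined by its values at two distinct points, so the two
  -- hash values are jointly uniform.
  have hφ : Function.Bijective φ := by
    rw [← Finite.injective_iff_bijective]
    rintro ⟨a, b⟩ ⟨a', b'⟩ h
    simp only [φ, Prod.mk.injEq] at h
    have h1 : (a - a') * (x - y) = 0 := by linear_combination h.1 - h.2
    have h2 : a = a' := by
      rcases mul_eq_zero.1 h1 with h | h
      · exact sub_eq_zero.1 h
      · exact absurd h hxy'
    subst h2
    have h3 := h.1
    rw [add_right_inj] at h3
    rw [h3]
  rw [Fintype.expect_eq_sum_div_card, Fintype.card_prod, ZMod.card]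
  let g : ZMod P → ℝ := fun z => if z.val < s then 1 else 0
  have hg : ∑ z, g z = s := card_val_lt hs
  have : ∑ w, affineInd s x w * affineInd s y w = ∑ z : ZMod P × ZMod P, g z.1 * g z.2 :=
    Fintype.sum_bijective φ hφ _ _ fun w => rfl
  rw [this, Fintype.sum_prod_type, ← Fintype.sum_mul_sum, hg]
  push_cast
  field_simp

lemma affineInd_idem (s : ℕ) (x : ZMod P) (w : ZMod P × ZMod P) :
    affineInd s x w * affineInd s x w = affineInd s x w := by
  unfold affineInd
  split_ifs <;> norm_num

end Hash

/-! ### Algorithms that are deterministic apart from a random seed -/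

/-- A `p`-pass algorithm with memory `C` whose only randomness is a seed from `Ω`. -/
structure SeededMachine (α : Type) (p : ℕ) (Ω C : Type) where
  init : C
  step : Ω → Fin p → C → α → C
  endPass : Ω → Fin p → C → C
  output : Ω → C → ℝ

namespace SeededMachine

variable {α Ω C : Type} {p : ℕ}

/-- The final memory for a given seed. -/
def run (M : SeededMachine α p Ω C) (w : Ω) (σ : List α) : C :=
  (List.finRange p).foldl (fun c i => M.endPass w i (σ.foldl (M.step w i) c)) M.init

variable [Fintype Ω] [Nonempty Ω] [Fintype C]

/-- The streaming algorithm that runs `r` copies of `M` with independent uniform seeds, which are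
kept in memory, and returns the median of the outputs. -/
noncomputable def medianAlgorithm (M : SeededMachine α p Ω C) (r : ℕ) : StreamAlgorithm α p where
  State := Fin r → Ω × C
  init := (PMF.uniformOfFintype (Fin r → Ω)).map (fun w j => (w j, M.init))
  step i s a := PMF.pure (fun j => ((s j).1, M.step (s j).1 i (s j).2 a))
  endPass i s := PMF.pure (fun j => ((s j).1, M.endPass (s j).1 i (s j).2))
  output s := upperMedian (fun j => M.output (s j).1 (s j).2)

/-- The memory of the `r` copies of `M` with seeds `w` whose contents are `c`. -/
def joint (M : SeededMachine α p Ω C) (r : ℕ) (w : Fin r → Ω) (c : Ω → C) :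
    (M.medianAlgorithm r).State :=
  fun j => (w j, c (w j))

/-- All coins are tossed at initialisation and later transitions are point masses. Thus the memory
law stays the image of the uniform seed law under a deterministic map. -/
lemma foldl_joint (M : SeededMachine α p Ω C) (r : ℕ) (σ : List α) (i : Fin p) (c : Ω → C) :
    σ.foldl (fun ν a => ν.bind (fun s => (M.medianAlgorithm r).step i s a))
        ((PMF.uniformOfFintype (Fin r → Ω)).map (fun w => M.joint r w c)) =
      (PMF.uniformOfFintype (Fin r → Ω)).map
        (fun w => M.joint r w (fun x => σ.foldl (M.step x i) (c x))) := by
  induction σ generalizing c with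
  | nil => rfl
  | cons a σ ih =>
    rw [List.foldl_cons]
    have : ((PMF.uniformOfFintype (Fin r → Ω)).map (fun w => M.joint r w c)).bind
        (fun s => (M.medianAlgorithm r).step i s a) =
        (PMF.uniformOfFintype (Fin r → Ω)).map
          (fun w => M.joint r w (fun x => M.step x i (c x) a)) :=
      (PMF.bind_pure_comp _ _).trans (PMF.map_comp _ _ _)
    rw [this]
    exact ih (fun x => M.step x i (c x) a)

lemma runPass_medianAlgorithm (M : SeededMachine α p Ω C) (r : ℕ) (σ : List α)
    (c : Ω → C) (i : Fin p) :
    (M.medianAlgorithm r).runPass σ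
        ((PMF.uniformOfFintype (Fin r → Ω)).map (fun w => M.joint r w c)) i =
      (PMF.uniformOfFintype (Fin r → Ω)).map
        (fun w => M.joint r w (fun x => M.endPass x i (σ.foldl (M.step x i) (c x)))) := by
  unfold StreamAlgorithm.runPass
  rw [foldl_joint]
  exact (PMF.bind_pure_comp _ _).trans (PMF.map_comp _ _ _)

lemma run_medianAlgorithm (M : SeededMachine α p Ω C) (r : ℕ) (σ : List α) :
    (M.medianAlgorithm r).run σ =
      (PMF.uniformOfFintype (Fin r → Ω)).map (fun w => M.joint r w (fun x => M.run x σ)) := by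
  have key : ∀ (l : List (Fin p)) (c : Ω → C),
      l.foldl ((M.medianAlgorithm r).runPass σ)
        ((PMF.uniformOfFintype (Fin r → Ω)).map (fun w => M.joint r w c)) =
      (PMF.uniformOfFintype (Fin r → Ω)).map (fun w => M.joint r w (fun x => l.foldl
        (fun c i => M.endPass x i (σ.foldl (M.step x i) c)) (c x))) := by
    intro l
    induction l with
    | nil => intro c; rfl
    | cons i l ih =>
      intro c
      rw [List.foldl_cons, runPass_medianAlgorithm]
      exact ih (fun x => M.endPass x i (σ.foldl (M.step x i) (c x)))
  exact key _ (fun _ => M.init)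

lemma card_state_medianAlgorithm (M : SeededMachine α p Ω C) (r : ℕ) :
    Fintype.card (M.medianAlgorithm r).State = (Fintype.card Ω * Fintype.card C) ^ r := by
  have : Fintype.card (Fin r → Ω × C) = (Fintype.card Ω * Fintype.card C) ^ r := by simp
  rw [← this]
  congr!

/-- If a single copy succeeds with probability at least `15 / 16`, then the median of `r` copies
succeeds with probability at least `1 - 2⁻ʳ`. -/
lemma estimates_medianAlgorithm (M : SeededMachine α p Ω C) (r : ℕ) (σ : List α) (Q ε δ : ℝ)
    [DecidableEq Ω] (bad : Finset Ω) (hbad : (bad.card : ℝ) ≤ Fintype.card Ω / 16)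
    (hgood : ∀ w ∉ bad, |M.output w (M.run w σ) - Q| ≤ ε * Q) (hδ : 1 / 2 ^ r ≤ δ) :
    (M.medianAlgorithm r).Estimates σ Q ε δ := by
  classical
  unfold StreamAlgorithm.Estimates
  rw [run_medianAlgorithm, PMF.toOuterMeasure_map_apply]
  set B := Finset.univ.filter (fun w : Fin r → Ω =>
    r ≤ 2 * (Finset.univ.filter (fun i => w i ∈ bad)).card) with hB
  have hsub : ((Bᶜ : Finset (Fin r → Ω)) : Set (Fin r → Ω)) ⊆
      (fun w => M.joint r w (fun x => M.run x σ)) ⁻¹'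
        {s | |(M.medianAlgorithm r).output s - Q| ≤ ε * Q} := by
    intro w hw
    rw [Finset.mem_coe, Finset.mem_compl, hB, Finset.mem_filter] at hw
    simp only [Finset.mem_univ, true_and, not_le] at hw
    show |upperMedian (fun j => M.output (w j) (M.run (w j) σ)) - Q| ≤ ε * Q
    have h1 : r < 2 * (Finset.univ.filter (fun j => M.output (w j) (M.run (w j) σ) ∈
        Set.Icc (Q - ε * Q) (Q + ε * Q))).card := by
      have h2 := Finset.card_filter_add_card_filter_not
        (s := (Finset.univ : Finset (Fin r))) (fun i => w i ∈ bad)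
      rw [Finset.card_univ, Fintype.card_fin] at h2
      have h3 : (Finset.univ.filter (fun i => ¬ w i ∈ bad)).card ≤
          (Finset.univ.filter (fun j => M.output (w j) (M.run (w j) σ) ∈
            Set.Icc (Q - ε * Q) (Q + ε * Q))).card := by
        gcongr with i
        intro hi
        have := abs_le.1 (hgood _ hi)
        constructor <;> linarith [this.1, this.2]
      omega
    have h4 := upperMedian_mem_Icc _ _ _ h1
    rw [abs_le]
    constructor <;> linarith [h4.1, h4.2]
  refine le_trans ?_ (MeasureTheory.measure_mono hsub)
  rw [PMF.toOuterMeasure_uniformOfFintype_apply]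
  have hcard : Fintype.card ((Bᶜ : Finset (Fin r → Ω)) : Set (Fin r → Ω)) = Bᶜ.card :=
    Fintype.card_coe _
  have hN : (0 : ℝ) < (Fintype.card (Fin r → Ω) : ℝ) := by exact_mod_cast Fintype.card_pos
  rw [hcard, ← ENNReal.ofReal_natCast, ← ENNReal.ofReal_natCast (Fintype.card (Fin r → Ω)),
    ← ENNReal.ofReal_div_of_pos hN]
  apply ENNReal.ofReal_le_ofReal
  have h1 := card_majority_bad_le bad hbad r
  rw [← hB] at h1
  have h2 : (Bᶜ.card : ℝ) = Fintype.card (Fin r → Ω) - B.card := by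
    rw [Finset.card_compl, Nat.cast_sub (Finset.card_le_univ _)]
  have h3 : (Fintype.card (Fin r → Ω) : ℝ) = (Fintype.card Ω : ℝ) ^ r := by simp
  rw [h2, le_div_iff₀ hN]
  have h4 : (Fintype.card Ω : ℝ) ^ r / 2 ^ r ≤ δ * Fintype.card (Fin r → Ω) := by
    rw [h3, div_eq_mul_one_div, mul_comm]
    gcongr
  linarith

end SeededMachine

/-! ### Bounded encodings of the memory -/

/-- If a machine works on encoded memories and all intended memories along the stream are encodable,
then the machine follows the intended memories. -/
lemma dec_foldl_enc {α S C : Type} [Nonempty C] (dec : C → S) (step : S → α → S)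
    (F : List α → S) (σ : List α) (hstep : ∀ l a, step (F l) a = F (l ++ [a]))
    (hF : ∀ l, l <+: σ → F l ∈ Set.range dec) (c : C) (hc : dec c = F []) :
    dec (σ.foldl (fun c a => Function.invFun dec (step (dec c) a)) c) = F σ := by
  have key : ∀ l' l : List α, l ++ l' = σ → ∀ c, dec c = F l →
      dec (l'.foldl (fun c a => Function.invFun dec (step (dec c) a)) c) = F σ := by
    intro l'
    induction l' with
    | nil =>
      intro l hl c hc
      rw [List.append_nil] at hl
      rw [List.foldl_nil, hc, hl]
    | cons a l' ih =>
      intro l hl c hc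
      have hl' : (l ++ [a]) ++ l' = σ := by simpa using hl
      rw [List.foldl_cons]
      apply ih _ hl'
      rw [hc, hstep]
      exact Function.invFun_eq (hF _ ⟨l', hl'⟩)
  exact key σ [] (List.nil_append σ) c hc

/-- The finite set listed by `f`. -/
noncomputable def listedSet {L : ℕ} {α : Type} [Fintype α] (f : Fin L → Option α) : Finset α :=
  open Classical in Finset.univ.filter (fun a => ∃ i, f i = some a)

lemma exists_listedSet_eq {L : ℕ} {α : Type} [Fintype α] (R : Finset α) (h : R.card ≤ L) :
    ∃ f : Fin L → Option α, listedSet f = R := by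
  classical
  refine ⟨fun i => if hi : (i : ℕ) < R.card then some (R.equivFin.symm ⟨i, hi⟩ : α) else none, ?_⟩
  ext a
  unfold listedSet
  simp only [Finset.mem_filter, Finset.mem_univ, true_and]
  constructor
  · rintro ⟨i, hi⟩
    split_ifs at hi with h'
    · rw [Option.some.injEq] at hi
      rw [← hi]
      exact (R.equivFin.symm _).2
  · intro ha
    refine ⟨⟨R.equivFin ⟨a, ha⟩, (Fin.is_lt _).trans_le h⟩, ?_⟩
    simp

/-- The sets of at most `k + 1` vertices. -/
abbrev SmallSet (n k : ℕ) : Type := {s : Finset (Fin n) // s.card ≤ k + 1}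

lemma card_smallSet_le (n k : ℕ) : Fintype.card (SmallSet n k) ≤ (n + 1) ^ (k + 1) := by
  have hsurj : ∀ s : SmallSet n k, ∃ f : Fin (k + 1) → Option (Fin n), listedSet f = s.1 :=
    fun s => exists_listedSet_eq s.1 s.2
  choose f hf using hsurj
  have hinj : Function.Injective f := by
    intro s t hst
    apply Subtype.ext
    rw [← hf s, ← hf t, hst]
  have := Fintype.card_le_of_injective f hinj
  simpa using this

/-- The contents of the working memory: a set of hyperedges, a counter for every vertex, and a set
of vertex sets. -/
structure SimplexMem (n : ℕ) where
  kept : Finset (Finset (Fin n))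
  count : Fin n → ℕ
  found : Finset (Finset (Fin n))

/-- Memory contents with at most `L` entries of each kind. -/
abbrev SimplexCode (n k m L : ℕ) : Type :=
  (Fin L → Option (SmallSet n k)) × (Fin L → Option (Fin n × Fin (m + 1))) ×
    (Fin L → Option (SmallSet n k))

/-- The memory contents that are represented by a code. -/
noncomputable def SimplexCode.decode {n k m L : ℕ} (c : SimplexCode n k m L) : SimplexMem n where
  kept := (listedSet c.1).map (Function.Embedding.subtype _)
  count v := ((listedSet c.2.1).filter (fun x => x.1 = v)).sup (fun x => (x.2 : ℕ))
  found := (listedSet c.2.2).map (Function.Embedding.subtype _)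

lemma exists_map_listedSet_eq {n k L : ℕ} (R : Finset (Finset (Fin n)))
    (hR : ∀ e ∈ R, e.card ≤ k + 1) (h : R.card ≤ L) :
    ∃ f : Fin L → Option (SmallSet n k),
      (listedSet f).map (Function.Embedding.subtype _) = R := by
  classical
  obtain ⟨f, hf⟩ := exists_listedSet_eq (L := L) (R.subtype (fun s => s.card ≤ k + 1)) (by
    rw [Finset.card_subtype]
    exact (Finset.card_filter_le _ _).trans h)
  exact ⟨f, by rw [hf, Finset.subtype_map_of_mem hR]⟩

/-- Counters are stored only on the support `U`; an unlisted vertex decodes to an empty supremum,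
which is zero. -/
lemma SimplexCode.mem_range_decode {n k m L : ℕ} (s : SimplexMem n)
    (h1 : ∀ e ∈ s.kept, e.card ≤ k + 1) (h2 : s.kept.card ≤ L)
    (h3 : ∀ v, s.count v ≤ m) (U : Finset (Fin n)) (h4 : U.card ≤ L) (h5 : ∀ v ∉ U, s.count v = 0)
    (h6 : ∀ X ∈ s.found, X.card ≤ k + 1) (h7 : s.found.card ≤ L) :
    s ∈ Set.range (SimplexCode.decode (n := n) (k := k) (m := m) (L := L)) := by
  obtain ⟨R, d, Q⟩ := s
  obtain ⟨f, hf⟩ := exists_map_listedSet_eq R h1 h2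
  obtain ⟨g, hg⟩ := exists_map_listedSet_eq Q h6 h7
  obtain ⟨t, ht⟩ := exists_listedSet_eq (L := L)
    (U.image (fun v => (v, (⟨d v, Nat.lt_succ_of_le (h3 v)⟩ : Fin (m + 1)))))
    (Finset.card_image_le.trans h4)
  refine ⟨(f, t, g), ?_⟩
  unfold SimplexCode.decode
  simp only [hf, hg, ht, SimplexMem.mk.injEq, true_and, and_true]
  funext v
  by_cases hv : v ∈ U
  · have : (U.image (fun v => (v, (⟨d v, Nat.lt_succ_of_le (h3 v)⟩ : Fin (m + 1))))).filter
        (fun x => x.1 = v) = {(v, ⟨d v, Nat.lt_succ_of_le (h3 v)⟩)} := by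
      ext ⟨u, c⟩
      simp only [Finset.mem_filter, Finset.mem_image, Prod.mk.injEq, Finset.mem_singleton]
      constructor
      · rintro ⟨⟨a, _, rfl, rfl⟩, rfl⟩
        exact ⟨rfl, rfl⟩
      · rintro ⟨rfl, rfl⟩
        exact ⟨⟨_, hv, rfl, rfl⟩, rfl⟩
    rw [this, Finset.sup_singleton]
  · have : (U.image (fun v => (v, (⟨d v, Nat.lt_succ_of_le (h3 v)⟩ : Fin (m + 1))))).filter
        (fun x => x.1 = v) = ∅ := by
      rw [Finset.filter_eq_empty_iff]
      rintro ⟨u, c⟩ hu rfl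
      simp only [Finset.mem_image, Prod.mk.injEq] at hu
      obtain ⟨a, ha, rfl, -⟩ := hu
      exact hv ha
    rw [this, Finset.sup_empty]
    exact (h5 v hv).symm

lemma SimplexCode.card_le (n k m L : ℕ) :
    Fintype.card (SimplexCode n k m L) ≤
      ((n + 1) ^ (k + 1) + 1) ^ L * ((n * (m + 1) + 1) ^ L * ((n + 1) ^ (k + 1) + 1) ^ L) := by
  have := card_smallSet_le n k
  simp only [Fintype.card_prod, Fintype.card_fun, Fintype.card_option, Fintype.card_fin]
  gcongr

/-! ### The four passes -/

section Passes

variable {n : ℕ}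

/-- The update of the memory when the hyperedge `e` is read. The passes sample hyperedges, count the
degrees of their vertices, sample candidates for simplices, and check the candidates while counting
the degrees of their vertices. -/
noncomputable def SimplexMem.step (k : ℕ) (sel₁ sel₂ : Finset (Fin n) → Prop) (i : Fin 4)
    (s : SimplexMem n) (e : Finset (Fin n)) : SimplexMem n :=
  open Classical in match i with
  | 0 => ⟨if sel₁ e then insert e s.kept else s.kept, s.count, s.found⟩
  | 1 => ⟨s.kept, fun v => if v ∈ e ∧ v ∈ s.kept.biUnion id then s.count v + 1 else s.count v,
      s.found⟩
  | 2 => ⟨s.kept, s.count, s.found ∪ ((s.kept.filter (fun f => lowVertex s.count f ⊆ e)).image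
      (fun f => f ∪ e)).filter (fun X => X.card = k + 1 ∧ sel₂ X)⟩
  | 3 => ⟨if ∃ X ∈ s.found, e ⊆ X then insert e s.kept else s.kept,
      fun v => if v ∈ e ∧ v ∈ s.found.biUnion id then s.count v + 1 else s.count v, s.found⟩

/-- After the third pass only the candidates are kept. -/
def SimplexMem.endPass (i : Fin 4) (s : SimplexMem n) : SimplexMem n :=
  match i with
  | 2 => ⟨∅, fun _ => 0, s.found⟩
  | _ => s

/-- The sampled simplices that the final memory reveals. -/
noncomputable def SimplexMem.confirmed (k : ℕ) (sel₁ : Finset (Fin n) → Prop) (s : SimplexMem n) :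
    Finset (Finset (Fin n)) :=
  open Classical in s.found.filter
    (fun X => X.powersetCard k ⊆ s.kept ∧ sel₁ (simplexBase s.count X))

/-- The number of listed sets that contain `v`, for `v` in `U`. -/
def trackedCount (U : Finset (Fin n)) (l : List (Finset (Fin n))) (v : Fin n) : ℕ :=
  if v ∈ U then l.countP (fun e => v ∈ e) else 0

lemma trackedCount_append (U : Finset (Fin n)) (l : List (Finset (Fin n))) (e : Finset (Fin n)) :
    (fun v => if v ∈ e ∧ v ∈ U then trackedCount U l v + 1 else trackedCount U l v) =
      trackedCount U (l ++ [e]) := by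
  funext v
  unfold trackedCount
  by_cases hU : v ∈ U
  · by_cases he : v ∈ e <;> simp [hU, he, List.countP_append]
  · simp [hU]

namespace KGraph

variable {k : ℕ}

/-- The sampled hyperedges. -/
noncomputable def sampledEdges (H : KGraph (Fin n) k) (sel₁ : Finset (Fin n) → Prop) :
    Finset (Finset (Fin n)) :=
  open Classical in H.edges.filter sel₁

/-- The sampled candidates. -/
noncomputable def sampledCandidates (H : KGraph (Fin n) k) (sel₁ sel₂ : Finset (Fin n) → Prop) :
    Finset (Finset (Fin n)) :=
  open Classical in (H.sampledEdges sel₁).biUnion (fun e => (H.candidates e).filter sel₂)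

/-- The memory in pass `i` after the hyperedges in `l` have been read. -/
noncomputable def memAt (H : KGraph (Fin n) k) (sel₁ sel₂ : Finset (Fin n) → Prop) (i : Fin 4)
    (l : List (Finset (Fin n))) : SimplexMem n :=
  open Classical in match i with
  | 0 => ⟨l.toFinset.filter sel₁, fun _ => 0, ∅⟩
  | 1 => ⟨H.sampledEdges sel₁, trackedCount ((H.sampledEdges sel₁).biUnion id) l, ∅⟩
  | 2 => ⟨H.sampledEdges sel₁,
      fun v => if v ∈ (H.sampledEdges sel₁).biUnion id then H.deg v else 0,
      (H.sampledEdges sel₁).biUnion (fun e =>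
        (((l.toFinset.filter (fun f => lowVertex H.deg e ⊆ f)).image (fun f => e ∪ f)).filter
          (fun X => X.card = k + 1)).filter sel₂)⟩
  | 3 => ⟨l.toFinset.filter (fun e => ∃ X ∈ H.sampledCandidates sel₁ sel₂, e ⊆ X),
      trackedCount ((H.sampledCandidates sel₁ sel₂).biUnion id) l,
      H.sampledCandidates sel₁ sel₂⟩

/-- This is the loop invariant: `memAt` describes the memory in closed form, without any capacity
restriction. -/
lemma step_memAt (H : KGraph (Fin n) k) (sel₁ sel₂ : Finset (Fin n) → Prop) (i : Fin 4)
    (l : List (Finset (Fin n))) (e : Finset (Fin n)) :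
    SimplexMem.step k sel₁ sel₂ i (H.memAt sel₁ sel₂ i l) e =
      H.memAt sel₁ sel₂ i (l ++ [e]) := by
  classical
  match i with
  | 0 =>
    simp only [SimplexMem.step, memAt, SimplexMem.mk.injEq, and_true]
    ext f
    by_cases he : sel₁ e
    · simp only [he, if_true, Finset.mem_insert, Finset.mem_filter, List.toFinset_append,
        Finset.mem_union, List.mem_toFinset, List.mem_singleton]
      constructor
      · rintro (rfl | h)
        · exact ⟨Or.inr rfl, he⟩
        · exact ⟨Or.inl h.1, h.2⟩
      · rintro ⟨h | h, h'⟩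
        · exact Or.inr ⟨h, h'⟩
        · exact Or.inl h
    · simp only [he, if_false, Finset.mem_filter, List.toFinset_append,
        Finset.mem_union, List.mem_toFinset, List.mem_singleton]
      constructor
      · rintro ⟨h, h'⟩
        exact ⟨Or.inl h, h'⟩
      · rintro ⟨h | rfl, h'⟩
        · exact ⟨h, h'⟩
        · exact absurd h' he
  | 1 =>
    simp only [SimplexMem.step, memAt, SimplexMem.mk.injEq, and_true, true_and]
    exact trackedCount_append _ _ _
  | 2 =>
    simp only [SimplexMem.step, memAt, SimplexMem.mk.injEq, true_and]
    -- The counters are correct on every vertex of a sampled hyperedge, so the low vertex computed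
    -- from them is the one chosen with the true degrees.
    have hlow : ∀ f ∈ H.sampledEdges sel₁,
        lowVertex (fun v => if v ∈ (H.sampledEdges sel₁).biUnion id then H.deg v else 0) f =
          lowVertex H.deg f := by
      intro f hf
      apply lowVertex_congr
      intro v hv
      rw [if_pos (Finset.mem_biUnion.2 ⟨f, hf, hv⟩)]
    simp only [Finset.mem_biUnion] at hlow
    ext X
    simp only [Finset.mem_union, Finset.mem_biUnion, Finset.mem_filter, Finset.mem_image,
      List.toFinset_append, List.mem_toFinset, List.mem_singleton]
    constructor
    · rintro (⟨f, hf, ⟨⟨g, hg, rfl⟩, hc⟩, hs⟩ | ⟨⟨f, ⟨hf, hl⟩, rfl⟩, hc, hs⟩)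
      · exact ⟨f, hf, ⟨⟨g, ⟨Or.inl hg.1, hg.2⟩, rfl⟩, hc⟩, hs⟩
      · rw [hlow f hf] at hl
        exact ⟨f, hf, ⟨⟨e, ⟨Or.inr rfl, hl⟩, rfl⟩, hc⟩, hs⟩
    · rintro ⟨f, hf, ⟨⟨g, ⟨hg | rfl, hl⟩, rfl⟩, hc⟩, hs⟩
      · exact Or.inl ⟨f, hf, ⟨⟨g, ⟨hg, hl⟩, rfl⟩, hc⟩, hs⟩
      · rw [← hlow f hf] at hl
        exact Or.inr ⟨⟨f, ⟨hf, hl⟩, rfl⟩, hc, hs⟩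
  | 3 =>
    simp only [SimplexMem.step, memAt, SimplexMem.mk.injEq, and_true]
    refine ⟨?_, trackedCount_append _ _ _⟩
    ext f
    by_cases he : ∃ X ∈ H.sampledCandidates sel₁ sel₂, e ⊆ X
    · simp only [he, if_true, Finset.mem_insert, Finset.mem_filter, List.toFinset_append,
        Finset.mem_union, List.mem_toFinset, List.mem_singleton]
      constructor
      · rintro (rfl | h)
        · exact ⟨Or.inr rfl, he⟩
        · exact ⟨Or.inl h.1, h.2⟩
      · rintro ⟨h | h, h'⟩
        · exact Or.inr ⟨h, h'⟩
        · exact Or.inl h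
    · simp only [he, if_false, Finset.mem_filter, List.toFinset_append,
        Finset.mem_union, List.mem_toFinset, List.mem_singleton]
      constructor
      · rintro ⟨h, h'⟩
        exact ⟨Or.inl h, h'⟩
      · rintro ⟨h | rfl, h'⟩
        · exact ⟨h, h'⟩
        · exact absurd h' he

lemma IsStream.toFinset_eq {H : KGraph (Fin n) k} {σ : List (Finset (Fin n))}
    (hσ : H.IsStream σ) : σ.toFinset = H.edges := by
  ext e
  rw [List.mem_toFinset, hσ.2]

lemma IsStream.length_eq {H : KGraph (Fin n) k} {σ : List (Finset (Fin n))}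
    (hσ : H.IsStream σ) : σ.length = H.edges.card := by
  rw [← hσ.toFinset_eq, List.toFinset_card_of_nodup hσ.1]

lemma IsStream.countP_eq {H : KGraph (Fin n) k} (hk : 2 ≤ k) {σ : List (Finset (Fin n))}
    (hσ : H.IsStream σ) (v : Fin n) : σ.countP (fun e => v ∈ e) = H.deg v := by
  rw [H.deg_eq_card hk, ← hσ.toFinset_eq, List.countP_eq_length_filter,
    ← List.toFinset_card_of_nodup (hσ.1.filter _)]
  congr 1
  ext e
  simp

lemma IsStream.trackedCount_eq {H : KGraph (Fin n) k} (hk : 2 ≤ k) {σ : List (Finset (Fin n))}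
    (hσ : H.IsStream σ) (U : Finset (Fin n)) :
    trackedCount U σ = fun v => if v ∈ U then H.deg v else 0 := by
  funext v
  unfold trackedCount
  rw [hσ.countP_eq hk]

lemma IsStream.endPass_memAt {H : KGraph (Fin n) k} (hk : 2 ≤ k) {σ : List (Finset (Fin n))}
    (hσ : H.IsStream σ) (sel₁ sel₂ : Finset (Fin n) → Prop) :
    SimplexMem.endPass 0 (H.memAt sel₁ sel₂ 0 σ) = H.memAt sel₁ sel₂ 1 [] ∧
    SimplexMem.endPass 1 (H.memAt sel₁ sel₂ 1 σ) = H.memAt sel₁ sel₂ 2 [] ∧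
    SimplexMem.endPass 2 (H.memAt sel₁ sel₂ 2 σ) = H.memAt sel₁ sel₂ 3 [] ∧
    SimplexMem.endPass 3 (H.memAt sel₁ sel₂ 3 σ) = H.memAt sel₁ sel₂ 3 σ := by
  classical
  refine ⟨?_, ?_, ?_, rfl⟩
  · simp only [SimplexMem.endPass, memAt, SimplexMem.mk.injEq, and_true, hσ.toFinset_eq]
    refine ⟨rfl, ?_⟩
    funext v
    simp [trackedCount]
  · simp only [SimplexMem.endPass, memAt, SimplexMem.mk.injEq, true_and, hσ.trackedCount_eq hk]
    ext X
    simp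
  · simp only [SimplexMem.endPass, memAt, SimplexMem.mk.injEq, hσ.toFinset_eq]
    refine ⟨by simp, ?_, rfl⟩
    funext v
    simp [trackedCount]

lemma card_sampledCandidates_le (H : KGraph (Fin n) k) (sel₁ sel₂ : Finset (Fin n) → Prop)
    {X : Finset (Fin n)} (hX : X ∈ H.sampledCandidates sel₁ sel₂) : X.card = k + 1 ∧ sel₂ X := by
  classical
  unfold sampledCandidates at hX
  obtain ⟨e, -, hX⟩ := Finset.mem_biUnion.1 hX
  rw [Finset.mem_filter] at hX
  exact ⟨(Finset.mem_filter.1 hX.1).2, hX.2⟩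

/-- The memory stays small if few hyperedges and few candidates are sampled. -/
lemma IsStream.memAt_mem_range {H : KGraph (Fin n) k} {σ : List (Finset (Fin n))}
    (hσ : H.IsStream σ) (hk : 2 ≤ k) (sel₁ sel₂ : Finset (Fin n) → Prop) {L : ℕ}
    (h1 : (k + 1) * (H.sampledEdges sel₁).card ≤ L)
    (h2 : (k + 1) * (H.sampledCandidates sel₁ sel₂).card ≤ L) (i : Fin 4)
    (l : List (Finset (Fin n))) (hl : l <+: σ) :
    H.memAt sel₁ sel₂ i l ∈ Set.range
      (SimplexCode.decode (n := n) (k := k) (m := H.edges.card) (L := L)) := by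
  classical
  have hlE : l.toFinset ⊆ H.edges := by
    rw [← hσ.toFinset_eq]
    intro e he
    rw [List.mem_toFinset] at he ⊢
    exact hl.subset he
  have hcardE : ∀ e ∈ H.edges, e.card ≤ k + 1 := fun e he => by rw [H.uniform e he]; omega
  have hR : ∀ e ∈ H.sampledEdges sel₁, e ∈ H.edges := fun e he => (Finset.mem_filter.1 he).1
  have h1' : (H.sampledEdges sel₁).card ≤ L :=
    (Nat.le_mul_of_pos_left _ (by omega)).trans h1
  have h2' : (H.sampledCandidates sel₁ sel₂).card ≤ L :=
    (Nat.le_mul_of_pos_left _ (by omega)).trans h2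
  have hUR : ((H.sampledEdges sel₁).biUnion id).card ≤ L := by
    refine le_trans ?_ h1
    rw [mul_comm]
    exact Finset.card_biUnion_le_card_mul _ _ _ fun e he => hcardE e (hR e he)
  have hUQ : ((H.sampledCandidates sel₁ sel₂).biUnion id).card ≤ L := by
    refine le_trans ?_ h2
    rw [mul_comm]
    exact Finset.card_biUnion_le_card_mul _ _ _
      fun X hX => (H.card_sampledCandidates_le sel₁ sel₂ hX).1.le
  have hQc : ∀ X ∈ H.sampledCandidates sel₁ sel₂, X.card ≤ k + 1 :=
    fun X hX => (H.card_sampledCandidates_le sel₁ sel₂ hX).1.le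
  have htr : ∀ (U : Finset (Fin n)) v, trackedCount U l v ≤ H.edges.card := by
    intro U v
    unfold trackedCount
    split_ifs
    · rw [← hσ.length_eq]
      exact List.countP_le_length.trans hl.length_le
    · exact Nat.zero_le _
  have htr0 : ∀ (U : Finset (Fin n)), ∀ v ∉ U, trackedCount U l v = 0 := by
    intro U v hv
    unfold trackedCount
    rw [if_neg hv]
  match i with
  | 0 =>
    refine SimplexCode.mem_range_decode _ ?_ ?_ ?_ ∅ (by simp) ?_ ?_ ?_
    · exact fun e he => hcardE e (hlE (Finset.mem_filter.1 he).1)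
    · exact (Finset.card_le_card (Finset.filter_subset_filter _ hlE)).trans h1'
    · exact fun v => Nat.zero_le _
    · exact fun v _ => rfl
    · simp [memAt]
    · simp [memAt]
  | 1 =>
    refine SimplexCode.mem_range_decode _ ?_ h1' (htr _) _ hUR (htr0 _) ?_ ?_
    · exact fun e he => hcardE e (hR e he)
    · simp [memAt]
    · simp [memAt]
  | 2 =>
    have hsub : (H.memAt sel₁ sel₂ 2 l).found ⊆ H.sampledCandidates sel₁ sel₂ := by
      apply Finset.biUnion_mono
      intro e _
      apply Finset.filter_subset_filter
      apply Finset.filter_subset_filter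
      apply Finset.image_subset_image
      exact Finset.filter_subset_filter _ hlE
    refine SimplexCode.mem_range_decode _ ?_ h1' ?_ _ hUR ?_ ?_ ?_
    · exact fun e he => hcardE e (hR e he)
    · intro v
      simp only [memAt]
      split_ifs
      · rw [H.deg_eq_card hk]
        exact Finset.card_filter_le _ _
      · exact Nat.zero_le _
    · intro v hv
      simp only [memAt]
      rw [if_neg hv]
    · exact fun X hX => hQc X (hsub hX)
    · exact (Finset.card_le_card hsub).trans h2'
  | 3 =>
    refine SimplexCode.mem_range_decode _ ?_ ?_ (htr _) _ hUQ (htr0 _) hQc h2'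
    · exact fun e he => hcardE e (hlE (Finset.mem_filter.1 he).1)
    · refine le_trans ?_ h2
      -- Every kept hyperedge is one of the `k + 1` facets of a candidate, so the capacity condition
      -- on candidates also covers the hyperedges kept in the last pass.
      have hsub : (H.memAt sel₁ sel₂ 3 l).kept ⊆
          (H.sampledCandidates sel₁ sel₂).biUnion (fun X => X.powersetCard k) := by
        intro e he
        obtain ⟨he, X, hX, heX⟩ := Finset.mem_filter.1 he
        exact Finset.mem_biUnion.2 ⟨X, hX, Finset.mem_powersetCard.2 ⟨heX, H.uniform e (hlE he)⟩⟩
      refine (Finset.card_le_card hsub).trans ?_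
      rw [mul_comm]
      refine Finset.card_biUnion_le_card_mul _ _ _ fun X hX => ?_
      rw [Finset.card_powersetCard, (H.card_sampledCandidates_le sel₁ sel₂ hX).1]
      simp

/-- The confirmed simplices are the simplices that are sampled together with their base. -/
lemma IsStream.confirmed_memAt {H : KGraph (Fin n) k} (hk : 2 ≤ k) {σ : List (Finset (Fin n))}
    (hσ : H.IsStream σ) (sel₁ sel₂ : Finset (Fin n) → Prop)
    [DecidablePred fun X => sel₁ (simplexBase H.deg X) ∧ sel₂ X] :
    (H.memAt sel₁ sel₂ 3 σ).confirmed k sel₁ =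
      H.simplices.filter (fun X => sel₁ (simplexBase H.deg X) ∧ sel₂ X) := by
  classical
  have hbase : ∀ X ∈ H.sampledCandidates sel₁ sel₂,
      simplexBase (H.memAt sel₁ sel₂ 3 σ).count X = simplexBase H.deg X := by
    intro X hX
    apply simplexBase_congr
    intro v hv
    simp only [memAt]
    rw [hσ.trackedCount_eq hk]
    exact if_pos (Finset.mem_biUnion.2 ⟨X, hX, hv⟩)
  ext X
  unfold SimplexMem.confirmed
  rw [Finset.mem_filter, Finset.mem_filter]
  constructor
  · rintro ⟨hX, hpow, hs⟩
    rw [hbase X hX] at hs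
    have hc := H.card_sampledCandidates_le sel₁ sel₂ hX
    refine ⟨H.mem_simplices.2 ⟨hc.1, fun e he => ?_⟩, hs, hc.2⟩
    rw [← hσ.toFinset_eq]
    exact (Finset.mem_filter.1 (hpow he)).1
  · rintro ⟨hX, hs, hs'⟩
    have hXQ : X ∈ H.sampledCandidates sel₁ sel₂ :=
      Finset.mem_biUnion.2 ⟨_, Finset.mem_filter.2 ⟨H.simplexBase_mem hX _, hs⟩,
        Finset.mem_filter.2 ⟨H.mem_candidates_simplexBase hk hX _, hs'⟩⟩
    refine ⟨hXQ, fun e he => ?_, ?_⟩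
    · refine Finset.mem_filter.2 ⟨?_, X, hXQ, (Finset.mem_powersetCard.1 he).1⟩
      rw [hσ.toFinset_eq]
      exact (H.mem_simplices.1 hX).2 he
    · rw [hbase X hXQ]
      exact hs

end KGraph

/-- The seeded four-pass machine, with memory restricted to `L` entries of each kind. The predicates
`sel₁` and `sel₂` say which sets the seed samples, with probabilities `p` and `q`. -/
noncomputable def simplexMachine (n k m L : ℕ) {Ω : Type} (sel₁ sel₂ : Ω → Finset (Fin n) → Prop)
    (p q : ℝ) : SeededMachine (Finset (Fin n)) 4 Ω (SimplexCode n k m L) where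
  init := Function.invFun SimplexCode.decode ⟨∅, fun _ => 0, ∅⟩
  step w i c e := Function.invFun SimplexCode.decode
    (SimplexMem.step k (sel₁ w) (sel₂ w) i c.decode e)
  endPass _ i c := Function.invFun SimplexCode.decode (SimplexMem.endPass i c.decode)
  output w c := (c.decode.confirmed k (sel₁ w)).card / (p * q)

/-- If the samples fit into `L` slots, every intended memory is encodable and the truncated machine
follows it through all passes. On overflow `Function.invFun` returns junk, which is charged to the
failure probability. -/
lemma KGraph.IsStream.output_simplexMachine {k : ℕ} {H : KGraph (Fin n) k} (hk : 2 ≤ k)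
    {σ : List (Finset (Fin n))} (hσ : H.IsStream σ) {Ω : Type}
    (sel₁ sel₂ : Ω → Finset (Fin n) → Prop) (p q : ℝ) {L : ℕ} (w : Ω)
    (h1 : (k + 1) * (H.sampledEdges (sel₁ w)).card ≤ L)
    (h2 : (k + 1) * (H.sampledCandidates (sel₁ w) (sel₂ w)).card ≤ L)
    [DecidablePred fun X => sel₁ w (simplexBase H.deg X) ∧ sel₂ w X] :
    (simplexMachine n k H.edges.card L sel₁ sel₂ p q).output w
        ((simplexMachine n k H.edges.card L sel₁ sel₂ p q).run w σ) =
      (H.simplices.filter (fun X => sel₁ w (simplexBase H.deg X) ∧ sel₂ w X)).card / (p * q) := by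
  classical
  set M := simplexMachine n k H.edges.card L sel₁ sel₂ p q with hM
  have hrange := hσ.memAt_mem_range hk (sel₁ w) (sel₂ w) h1 h2
  have hpass : ∀ (i : Fin 4) c, c.decode = H.memAt (sel₁ w) (sel₂ w) i [] →
      (σ.foldl (M.step w i) c).decode = H.memAt (sel₁ w) (sel₂ w) i σ := by
    intro i c hc
    exact dec_foldl_enc SimplexCode.decode _ _ σ (H.step_memAt (sel₁ w) (sel₂ w) i) (hrange i) c hc
  have hnext : ∀ (i : Fin 4) c s, c.decode = H.memAt (sel₁ w) (sel₂ w) i [] →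
      SimplexMem.endPass i (H.memAt (sel₁ w) (sel₂ w) i σ) = s →
      s ∈ Set.range (SimplexCode.decode (n := n) (k := k) (m := H.edges.card) (L := L)) →
      (M.endPass w i (σ.foldl (M.step w i) c)).decode = s := by
    intro i c s hc hs hsr
    show (Function.invFun SimplexCode.decode (SimplexMem.endPass i _)).decode = s
    rw [hpass i c hc, hs]
    exact Function.invFun_eq hsr
  obtain ⟨e0, e1, e2, e3⟩ := hσ.endPass_memAt hk (sel₁ w) (sel₂ w)
  have hnil : ([] : List (Finset (Fin n))) <+: σ := List.nil_prefix
  have h0 : M.init.decode = H.memAt (sel₁ w) (sel₂ w) 0 [] := by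
    have hz : (⟨∅, fun _ => 0, ∅⟩ : SimplexMem n) = H.memAt (sel₁ w) (sel₂ w) 0 [] := by
      simp [memAt]
    have hr := hrange 0 [] hnil
    rw [← hz] at hr ⊢
    exact Function.invFun_eq hr
  have s1 := hnext 0 _ _ h0 e0 (hrange 1 [] hnil)
  have s2 := hnext 1 _ _ s1 e1 (hrange 2 [] hnil)
  have s3 := hnext 2 _ _ s2 e2 (hrange 3 [] hnil)
  have s4 := hnext 3 _ _ s3 e3 (hrange 3 σ (List.prefix_refl σ))
  have hrun : (M.run w σ).decode = H.memAt (sel₁ w) (sel₂ w) 3 σ := s4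
  show ((M.run w σ).decode.confirmed k (sel₁ w)).card / (p * q) = _
  rw [hrun, hσ.confirmed_memAt hk]

end Passes

/-! ### The success probability of one copy -/

section Success

variable {n k P : ℕ}

/-- The code of a set of at most `k + 1` vertices. -/
noncomputable def setCode (ι : SmallSet n k → ZMod P) (X : Finset (Fin n)) : ZMod P :=
  if h : X.card ≤ k + 1 then ι ⟨X, h⟩ else 0

lemma setCode_ne {ι : SmallSet n k → ZMod P} (hι : Function.Injective ι) {X Y : Finset (Fin n)}
    (hX : X.card ≤ k + 1) (hY : Y.card ≤ k + 1) (h : X ≠ Y) : setCode ι X ≠ setCode ι Y := by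
  unfold setCode
  rw [dif_pos hX, dif_pos hY]
  intro hXY
  exact h (congrArg Subtype.val (hι hXY))

/-- `X` is sampled by the affine hash function with coefficients `w` and threshold `s`. -/
def hashSel (ι : SmallSet n k → ZMod P) (s : ℕ) (w : ZMod P × ZMod P) (X : Finset (Fin n)) : Prop :=
  (w.1 * setCode ι X + w.2).val < s

variable [Fact P.Prime]

lemma affineInd_setCode (ι : SmallSet n k → ZMod P) (s : ℕ) (w : ZMod P × ZMod P)
    (X : Finset (Fin n)) [Decidable (hashSel ι s w X)] :
    affineInd s (setCode ι X) w = if hashSel ι s w X then 1 else 0 := by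
  unfold affineInd hashSel
  congr

open scoped BigOperators in
lemma expect_card_sampledEdges (H : KGraph (Fin n) k) (ι : SmallSet n k → ZMod P)
    {s₁ : ℕ} (hs₁ : s₁ ≤ P) :
    𝔼 w : (ZMod P × ZMod P) × (ZMod P × ZMod P),
      ((H.sampledEdges (hashSel ι s₁ w.1)).card : ℝ) = (s₁ : ℝ) / P * H.edges.card := by
  classical
  have h : ∀ w : (ZMod P × ZMod P) × (ZMod P × ZMod P),
      ((H.sampledEdges (hashSel ι s₁ w.1)).card : ℝ) =
        ∑ e ∈ H.edges, affineInd s₁ (setCode ι e) w.1 * 1 := by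
    intro w
    simp_rw [affineInd_setCode, mul_one]
    rw [← Finset.sum_filter, Finset.sum_const, nsmul_eq_mul, mul_one]
    unfold KGraph.sampledEdges
    congr!
  simp_rw [h]
  rw [Finset.expect_sum_comm]
  have h2 : ∀ e ∈ H.edges, 𝔼 w : (ZMod P × ZMod P) × (ZMod P × ZMod P),
      affineInd s₁ (setCode ι e) w.1 * 1 = (s₁ : ℝ) / P := by
    intro e _
    rw [expect_prod_mul (affineInd s₁ (setCode ι e)) (fun _ => 1), expect_affineInd hs₁,
      Fintype.expect_const, mul_one]
  rw [Finset.sum_congr rfl h2, Finset.sum_const, nsmul_eq_mul, mul_comm]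

open scoped BigOperators in
lemma expect_card_sampledCandidates_le (H : KGraph (Fin n) k) (hk : 2 ≤ k)
    (ι : SmallSet n k → ZMod P) {s₁ s₂ : ℕ} (hs₁ : s₁ ≤ P) (hs₂ : s₂ ≤ P) :
    𝔼 w : (ZMod P × ZMod P) × (ZMod P × ZMod P),
      ((H.sampledCandidates (hashSel ι s₁ w.1) (hashSel ι s₂ w.2)).card : ℝ) ≤
        (s₁ : ℝ) / P * (s₂ / P) * ∑ e ∈ H.edges, (H.minDeg e : ℝ) := by
  classical
  have h : ∀ w : (ZMod P × ZMod P) × (ZMod P × ZMod P),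
      ((H.sampledCandidates (hashSel ι s₁ w.1) (hashSel ι s₂ w.2)).card : ℝ) ≤
        ∑ e ∈ H.edges, ∑ X ∈ H.candidates e,
          affineInd s₁ (setCode ι e) w.1 * affineInd s₂ (setCode ι X) w.2 := by
    intro w
    unfold KGraph.sampledCandidates KGraph.sampledEdges
    -- The union bound counts a candidate once for each sampled hyperedge that produces it; the
    -- overcount is harmless, since only an upper bound is needed.
    refine (Nat.cast_le.2 Finset.card_biUnion_le).trans ?_
    rw [Nat.cast_sum, Finset.sum_filter]
    refine Finset.sum_le_sum fun e _ => ?_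
    rw [← Finset.mul_sum, affineInd_setCode]
    split_ifs
    · rw [one_mul]
      simp_rw [affineInd_setCode]
      rw [← Finset.sum_filter, Finset.sum_const, nsmul_eq_mul, mul_one]
    · rw [zero_mul]
  refine (Finset.expect_le_expect fun w _ => h w).trans ?_
  rw [Finset.expect_sum_comm, Finset.mul_sum]
  refine Finset.sum_le_sum fun e he => ?_
  rw [Finset.expect_sum_comm]
  have h2 : ∀ X ∈ H.candidates e, 𝔼 w : (ZMod P × ZMod P) × (ZMod P × ZMod P),
      affineInd s₁ (setCode ι e) w.1 * affineInd s₂ (setCode ι X) w.2 =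
        (s₁ : ℝ) / P * (s₂ / P) := by
    intro X _
    rw [expect_prod_mul, expect_affineInd hs₁, expect_affineInd hs₂]
  rw [Finset.sum_congr rfl h2, Finset.sum_const, nsmul_eq_mul, mul_comm]
  gcongr
  exact_mod_cast H.card_candidates_le hk he

open scoped BigOperators in
lemma expect_sq_sampledSimplices_le (H : KGraph (Fin n) k) (hk : 2 ≤ k)
    {ι : SmallSet n k → ZMod P} (hι : Function.Injective ι) {s₁ s₂ : ℕ} (hs₁ : s₁ ≤ P)
    (hs₂ : s₂ ≤ P) (p q : ℝ) (hp : (s₁ : ℝ) / P = p) (hq : (s₂ : ℝ) / P = q) :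
    𝔼 w : (ZMod P × ZMod P) × (ZMod P × ZMod P),
      (∑ X ∈ H.simplices, affineInd s₁ (setCode ι (simplexBase H.deg X)) w.1 *
        affineInd s₂ (setCode ι X) w.2 - p * q * H.numSimplices) ^ 2 ≤
      H.numSimplices *
        (p * q * (1 - p * q) + p * (1 - p) * q ^ 2 * √(k * H.edges.card)) := by
  have hP : (0 : ℝ) < P := by exact_mod_cast (Fact.out : P.Prime).pos
  have hbound : ∀ s : ℕ, s ≤ P → (0 : ℝ) ≤ (s : ℝ) / P ∧ (s : ℝ) / P ≤ 1 := by
    intro s hs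
    exact ⟨by positivity, by rw [div_le_one hP]; exact_mod_cast hs⟩
  have hX : ∀ X ∈ H.simplices, X.card ≤ k + 1 := fun X hX => (H.mem_simplices.1 hX).1.le
  have hb : ∀ X ∈ H.simplices, (simplexBase H.deg X).card ≤ k + 1 := fun X hX => by
    rw [H.uniform _ (H.simplexBase_mem hX _)]; omega
  refine expect_sq_sample_le H.simplices (simplexBase H.deg)
    (fun e => affineInd s₁ (setCode ι e)) (fun X => affineInd s₂ (setCode ι X)) p q
    (√(k * H.edges.card)) (hp ▸ (hbound s₁ hs₁).1) (hp ▸ (hbound s₁ hs₁).2)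
    (hq ▸ (hbound s₂ hs₂).1) (hq ▸ (hbound s₂ hs₂).2) ?_ ?_ ?_ ?_ ?_ ?_ ?_
  · exact fun X _ => hp ▸ expect_affineInd hs₁ _
  · exact fun X _ => hq ▸ expect_affineInd hs₂ _
  · exact fun e w => affineInd_idem _ _ _
  · exact fun e w => affineInd_idem _ _ _
  · exact fun X hXs Y hYs hne =>
      hp ▸ expect_affineInd_mul hs₁ (setCode_ne hι (hb X hXs) (hb Y hYs) hne)
  · exact fun X hXs Y hYs hne =>
      hq ▸ expect_affineInd_mul hs₂ (setCode_ne hι (hX X hXs) (hX Y hYs) hne)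
  · exact fun e => H.card_simplexBase_fiber_le hk e

/-- One copy of the machine fails with probability at most `1 / 16`. -/
lemma exists_bad_seeds (H : KGraph (Fin n) k) (hk : 2 ≤ k) {σ : List (Finset (Fin n))}
    (hσ : H.IsStream σ) {ι : SmallSet n k → ZMod P} (hι : Function.Injective ι) {s₁ s₂ : ℕ}
    (hs₁ : s₁ ≤ P) (hs₂ : s₂ ≤ P) (p q ε : ℝ) (hp : (s₁ : ℝ) / P = p) (hq : (s₂ : ℝ) / P = q)
    (hp0 : 0 < p) (hq0 : 0 < q) (hε : 0 < ε) (L : ℕ) (hL : 0 < L)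
    (hT : 0 < (H.numSimplices : ℝ))
    (hcap₁ : 64 * (k + 1) * (p * H.edges.card) ≤ L)
    (hcap₂ : 64 * (k + 1) * (p * q * ∑ e ∈ H.edges, (H.minDeg e : ℝ)) ≤ L)
    (hvar₁ : (1 - p * q) * 128 ≤ p * q * ε ^ 2 * H.numSimplices)
    (hvar₂ : (1 - p) * √(k * H.edges.card) * 128 ≤ p * ε ^ 2 * H.numSimplices) :
    ∃ bad : Finset ((ZMod P × ZMod P) × (ZMod P × ZMod P)),
      (bad.card : ℝ) ≤ Fintype.card ((ZMod P × ZMod P) × (ZMod P × ZMod P)) / 16 ∧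
      ∀ w ∉ bad,
        |(simplexMachine n k H.edges.card L (fun w => hashSel ι s₁ w.1)
            (fun w => hashSel ι s₂ w.2) p q).output w
          ((simplexMachine n k H.edges.card L (fun w => hashSel ι s₁ w.1)
            (fun w => hashSel ι s₂ w.2) p q).run w σ) - H.numSimplices| ≤
          ε * H.numSimplices := by
  classical
  set Ω := (ZMod P × ZMod P) × (ZMod P × ZMod P) with hΩ
  set c : ℝ := L / (k + 1) with hc
  have hk1 : (0 : ℝ) < k + 1 := by positivity
  have hc0 : 0 < c := div_pos (by exact_mod_cast hL) hk1
  let Z : Ω → ℝ := fun w => ∑ X ∈ H.simplices,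
    affineInd s₁ (setCode ι (simplexBase H.deg X)) w.1 * affineInd s₂ (setCode ι X) w.2
  set N : ℝ := (H.numSimplices : ℝ) with hN
  -- Three failure events, each of probability at most `1/64`: too many sampled hyperedges, too many
  -- sampled candidates, and a large deviation of the estimate.
  have hb₁ := card_lt_le_of_expect_le
    (fun w : Ω => ((H.sampledEdges (hashSel ι s₁ w.1)).card : ℝ)) (fun w => by positivity) c hc0 (by
      rw [expect_card_sampledEdges H ι hs₁, hp, hc, div_div, le_div_iff₀ (by positivity)]
      linarith)
  have hb₂ := card_lt_le_of_expect_le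
    (fun w : Ω => ((H.sampledCandidates (hashSel ι s₁ w.1) (hashSel ι s₂ w.2)).card : ℝ))
    (fun w => by positivity) c hc0 (by
      refine (expect_card_sampledCandidates_le H hk ι hs₁ hs₂).trans ?_
      rw [hp, hq, hc, div_div, le_div_iff₀ (by positivity)]
      linarith)
  have hb₃ := card_lt_le_of_expect_le
    (fun w : Ω => (Z w - p * q * N) ^ 2) (fun w => by positivity) ((ε * (p * q * N)) ^ 2)
    (by positivity) (by
      refine (expect_sq_sampledSimplices_le H hk hι hs₁ hs₂ p q hp hq).trans ?_
      -- Each variance term is at most `(ε * p * q * N) ^ 2 / 128`, so the two together meet the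
      -- `1/64` required for Chebyshev.
      have h1 := mul_le_mul_of_nonneg_left hvar₁ (by positivity : 0 ≤ N * (p * q))
      have h2 := mul_le_mul_of_nonneg_left hvar₂ (by positivity : 0 ≤ N * (p * q ^ 2))
      rw [← hN]
      nlinarith)
  refine ⟨Finset.univ.filter (fun w : Ω => c < ((H.sampledEdges (hashSel ι s₁ w.1)).card : ℝ)) ∪
    Finset.univ.filter (fun w : Ω =>
      c < ((H.sampledCandidates (hashSel ι s₁ w.1) (hashSel ι s₂ w.2)).card : ℝ)) ∪
    Finset.univ.filter (fun w : Ω => (ε * (p * q * N)) ^ 2 < (Z w - p * q * N) ^ 2), ?_, ?_⟩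
  · have h1 := (Finset.card_union_le
      (Finset.univ.filter (fun w : Ω => c < ((H.sampledEdges (hashSel ι s₁ w.1)).card : ℝ)) ∪
        Finset.univ.filter (fun w : Ω =>
          c < ((H.sampledCandidates (hashSel ι s₁ w.1) (hashSel ι s₂ w.2)).card : ℝ)))
      (Finset.univ.filter (fun w : Ω => (ε * (p * q * N)) ^ 2 < (Z w - p * q * N) ^ 2)))
    have h2 := (Finset.card_union_le
      (Finset.univ.filter (fun w : Ω => c < ((H.sampledEdges (hashSel ι s₁ w.1)).card : ℝ)))
        (Finset.univ.filter (fun w : Ω =>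
          c < ((H.sampledCandidates (hashSel ι s₁ w.1) (hashSel ι s₂ w.2)).card : ℝ))))
    have h3 := h1.trans (Nat.add_le_add_right h2 _)
    have h4 := (Nat.cast_le (α := ℝ)).2 h3
    push_cast at h4
    have h5 : (0 : ℝ) ≤ Fintype.card Ω := by positivity
    linarith
  · intro w hw
    simp only [Finset.mem_union, Finset.mem_filter, Finset.mem_univ, true_and, not_or, not_lt] at hw
    obtain ⟨⟨hw₁, hw₂⟩, hw₃⟩ := hw
    rw [hc, le_div_iff₀ hk1, mul_comm] at hw₁ hw₂
    rw [hσ.output_simplexMachine hk (fun w : Ω => hashSel ι s₁ w.1)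
      (fun w : Ω => hashSel ι s₂ w.2) p q w (by exact_mod_cast hw₁) (by exact_mod_cast hw₂)]
    have hZ : ((H.simplices.filter (fun X => hashSel ι s₁ w.1 (simplexBase H.deg X) ∧
        hashSel ι s₂ w.2 X)).card : ℝ) = Z w := by
      simp only [Z, affineInd_setCode]
      rw [Finset.card_filter, Nat.cast_sum]
      refine Finset.sum_congr rfl fun X _ => ?_
      by_cases h1 : hashSel ι s₁ w.1 (simplexBase H.deg X) <;>
        by_cases h2 : hashSel ι s₂ w.2 X <;> simp [h1, h2]
    rw [hZ]
    have habs := abs_le.1 (abs_le_of_sq_le_sq hw₃ (by positivity))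
    have hpq : 0 < p * q := by positivity
    have heq : Z w / (p * q) - N = (Z w - p * q * N) / (p * q) := by
      field_simp
    rw [heq, abs_div, abs_of_pos hpq, div_le_iff₀ hpq, abs_le]
    constructor <;> nlinarith [habs.1, habs.2]

end Success

/-! ### The choice of the parameters -/

/-- The number of residues modulo `P` that are sampled in order to sample with probability about
`x`. -/
noncomputable def samplingThreshold (P : ℕ) (x : ℝ) : ℕ := min P ⌈x * P⌉₊

lemma samplingThreshold_le (P : ℕ) (x : ℝ) : samplingThreshold P x ≤ P := min_le_left _ _

/-- The hypothesis `1 ≤ x * P` says that the resolution `1/P` is fine enough for rounding up to lose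
at most a factor two; the last disjunction separates capping at one from rounding. -/
lemma samplingThreshold_spec {P : ℕ} (hP : 0 < P) {x : ℝ} (hx : 1 ≤ x * P) :
    0 < (samplingThreshold P x : ℝ) / P ∧ (samplingThreshold P x : ℝ) / P ≤ 1 ∧
      (samplingThreshold P x : ℝ) / P ≤ 2 * x ∧
      ((samplingThreshold P x : ℝ) / P = 1 ∨ x ≤ (samplingThreshold P x : ℝ) / P) := by
  have hP' : (0 : ℝ) < P := by exact_mod_cast hP
  have h0 : 0 < samplingThreshold P x :=
    lt_min hP (Nat.ceil_pos.2 (by linarith))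
  refine ⟨by positivity, ?_, ?_, ?_⟩
  · rw [div_le_one hP']
    exact_mod_cast samplingThreshold_le P x
  · rw [div_le_iff₀ hP']
    have h1 : (samplingThreshold P x : ℝ) ≤ ⌈x * P⌉₊ := by exact_mod_cast min_le_right _ _
    have h2 := (Nat.ceil_lt_add_one (by linarith : 0 ≤ x * P)).le
    linarith
  · rcases min_choice P ⌈x * P⌉₊ with h | h
    · left
      unfold samplingThreshold
      rw [h, div_self hP'.ne']
    · right
      unfold samplingThreshold
      rw [h, le_div_iff₀ hP']
      exact Nat.le_ceil _

/-- Bertrand's postulate: the field is large enough to code all small sets injectively, yet its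
elements still cost only `O(log n)` bits. -/
lemma exists_prime_hashing (n k : ℕ) : ∃ P : ℕ, P.Prime ∧ Fintype.card (SmallSet n k) ≤ P ∧
    P ≤ 2 * Fintype.card (SmallSet n k) := by
  have : Fintype.card (SmallSet n k) ≠ 0 := by
    have : Nonempty (SmallSet n k) := ⟨⟨∅, by simp⟩⟩
    exact Fintype.card_ne_zero
  obtain ⟨P, h1, h2, h3⟩ := Nat.exists_prime_lt_and_le_two_mul _ this
  exact ⟨P, h1, h2.le, h3⟩

/-- The prime modulus of the hash functions. -/
noncomputable def hashPrime (n k : ℕ) : ℕ := (exists_prime_hashing n k).choose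

lemma hashPrime_prime (n k : ℕ) : (hashPrime n k).Prime := (exists_prime_hashing n k).choose_spec.1

lemma card_le_hashPrime (n k : ℕ) : Fintype.card (SmallSet n k) ≤ hashPrime n k :=
  (exists_prime_hashing n k).choose_spec.2.1

lemma hashPrime_le (n k : ℕ) : hashPrime n k ≤ 2 * Fintype.card (SmallSet n k) :=
  (exists_prime_hashing n k).choose_spec.2.2

instance hashPrime_fact (n k : ℕ) : Fact (hashPrime n k).Prime := ⟨hashPrime_prime n k⟩

lemma exists_injective_hash (n k : ℕ) :
    ∃ ι : SmallSet n k → ZMod (hashPrime n k), Function.Injective ι := by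
  have : Fintype.card (SmallSet n k) ≤ Fintype.card (ZMod (hashPrime n k)) := by
    rw [ZMod.card]
    exact card_le_hashPrime n k
  obtain ⟨f⟩ := Function.Embedding.nonempty_of_card_le this
  exact ⟨f, f.injective⟩

/-- An injective coding of the sets of at most `k + 1` vertices by residues. -/
noncomputable def hashCode (n k : ℕ) : SmallSet n k → ZMod (hashPrime n k) :=
  (exists_injective_hash n k).choose

/-- The first sampling threshold. -/
noncomputable def edgeThreshold (n k m : ℕ) (T ε : ℝ) : ℕ :=
  samplingThreshold (hashPrime n k) (128 * √(k * m) / (ε ^ 2 * T))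

/-- The probability that a hyperedge is sampled. -/
noncomputable def edgeProb (n k m : ℕ) (T ε : ℝ) : ℝ :=
  (edgeThreshold n k m T ε : ℝ) / hashPrime n k

/-- The second sampling threshold. -/
noncomputable def candidateThreshold (n k m : ℕ) (T ε : ℝ) : ℕ :=
  samplingThreshold (hashPrime n k) (128 / (ε ^ 2 * T) / edgeProb n k m T ε)

/-- The probability that a candidate is sampled. -/
noncomputable def candidateProb (n k m : ℕ) (T ε : ℝ) : ℝ :=
  (candidateThreshold n k m T ε : ℝ) / hashPrime n k

/-- The ratio that governs the number of entries that are kept in memory. -/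
noncomputable def memoryScale (k m : ℕ) (T ε : ℝ) : ℝ :=
  (m : ℝ) ^ (2 - 1 / (k : ℝ)) / (ε ^ 2 * T)

/-- The number of entries that are kept in memory. -/
noncomputable def memoryCap (k m : ℕ) (T ε : ℝ) : ℕ :=
  ⌈16384 * (k + 1) * k ^ 2 * memoryScale k m T ε⌉₊

/-- The number of independent copies. -/
noncomputable def numCopies (δ : ℝ) : ℕ := ⌈Real.logb 2 (2 / δ)⌉₊

/-- The machine with these parameters. -/
noncomputable def countingMachine (n k m : ℕ) (T ε : ℝ) :
    SeededMachine (Finset (Fin n)) 4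
      ((ZMod (hashPrime n k) × ZMod (hashPrime n k)) × (ZMod (hashPrime n k) × ZMod (hashPrime n k)))
      (SimplexCode n k m (memoryCap k m T ε)) :=
  simplexMachine n k m (memoryCap k m T ε)
    (fun w => hashSel (hashCode n k) (edgeThreshold n k m T ε) w.1)
    (fun w => hashSel (hashCode n k) (candidateThreshold n k m T ε) w.2)
    (edgeProb n k m T ε) (candidateProb n k m T ε)

/-- An algorithm that uses no memory. -/
noncomputable def trivialAlgorithm (α : Type) (p : ℕ) : StreamAlgorithm α p where
  State := Unit
  init := PMF.pure ()
  step _ s _ := PMF.pure s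
  endPass _ s := PMF.pure s
  output _ := 0

lemma space_trivialAlgorithm (α : Type) (p : ℕ) : (trivialAlgorithm α p).space = 0 := by
  have : Fintype.card (trivialAlgorithm α p).State = 1 := Fintype.card_unit
  unfold StreamAlgorithm.space
  rw [this]
  simp

/-- The promise can be satisfied. -/
def Feasible (n k m : ℕ) (T : ℝ) : Prop :=
  ∃ H : KGraph (Fin n) k, H.edges.card = m ∧ T ≤ H.numSimplices

/-- The streaming algorithm for counting simplices. -/
noncomputable def countingAlgorithm (k n m : ℕ) (T ε δ : ℝ) :
    StreamAlgorithm (Finset (Fin n)) 4 :=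
  open Classical in if Feasible n k m T then
    (countingMachine n k m T ε).medianAlgorithm (numCopies δ)
  else trivialAlgorithm _ 4

section Parameters

variable {n k m : ℕ} {T ε δ : ℝ}

lemma card_edges_le_card_smallSet (H : KGraph (Fin n) k) :
    H.edges.card ≤ Fintype.card (SmallSet n k) := by
  rw [Fintype.card_subtype]
  apply Finset.card_le_card
  intro e he
  simp [H.uniform e he]

lemma numSimplices_le_card_smallSet (H : KGraph (Fin n) k) :
    H.numSimplices ≤ Fintype.card (SmallSet n k) := by
  rw [Fintype.card_subtype]
  apply Finset.card_le_card
  intro X hX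
  simp [(H.mem_simplices.1 hX).1]

/-- An unsatisfiable promise may have a space bound below one bit, so that case goes to the trivial
algorithm. Under a satisfiable one, these inequalities make the hash resolution sufficient and the
memory scale bounded below. -/
lemma Feasible.facts (hk : 2 ≤ k) (hT : 0 < T) (h : Feasible n k m T) :
    k + 1 ≤ n ∧ 1 ≤ m ∧ m ≤ Fintype.card (SmallSet n k) ∧
      T ≤ Fintype.card (SmallSet n k) ∧ T ≤ √(k * m) * m := by
  obtain ⟨H, rfl, hTH⟩ := h
  have hpos : 0 < H.simplices.card := by
    have : (0 : ℝ) < H.numSimplices := hT.trans_le hTH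
    exact_mod_cast this
  obtain ⟨X, hX⟩ := Finset.card_pos.1 hpos
  refine ⟨?_, Finset.card_pos.2 ⟨_, H.simplexBase_mem hX H.deg⟩, card_edges_le_card_smallSet H,
    hTH.trans (by exact_mod_cast numSimplices_le_card_smallSet H), hTH.trans (H.numSimplices_le hk)⟩
  have := Finset.card_le_univ X
  rw [(H.mem_simplices.1 hX).1, Fintype.card_fin] at this
  exact this

lemma one_le_sqrt_mul (hk : 2 ≤ k) (hm : 1 ≤ m) : 1 ≤ √((k : ℝ) * m) := by
  rw [Real.one_le_sqrt]
  have h1 : (2 : ℝ) ≤ k := by exact_mod_cast hk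
  have h2 : (1 : ℝ) ≤ m := by exact_mod_cast hm
  nlinarith

/-- The exponent `3/2` is at most `2 - 1/k` exactly because `k ≥ 2`; hence storing the sampled
hyperedges costs no more than storing the candidates is allowed to. -/
lemma sqrt_mul_mul_le (hk : 2 ≤ k) (hm : 1 ≤ m) :
    √((k : ℝ) * m) * m ≤ k * (m : ℝ) ^ (2 - 1 / (k : ℝ)) := by
  have h1 : (2 : ℝ) ≤ k := by exact_mod_cast hk
  have h2 : (1 : ℝ) ≤ m := by exact_mod_cast hm
  rw [Real.sqrt_mul (by positivity), mul_assoc]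
  have hk' : √(k : ℝ) ≤ k := by
    rw [Real.sqrt_le_left (by positivity)]
    nlinarith
  have hm' : √(m : ℝ) * m ≤ (m : ℝ) ^ (2 - 1 / (k : ℝ)) := by
    rw [Real.sqrt_eq_rpow, ← Real.rpow_add_one (by positivity)]
    apply Real.rpow_le_rpow_of_exponent_le h2
    have : 1 / (k : ℝ) ≤ 1 / 2 := one_div_le_one_div_of_le (by norm_num) h1
    linarith
  gcongr

/-- The number of simplices is at most `√(k * m) * m`, which bounds `T`. This lets rounding and
additive constants be absorbed into the main space term. -/
lemma Feasible.one_le_memoryScale (hk : 2 ≤ k) (hT : 0 < T) (hε : 0 < ε) (hε1 : ε ≤ 1)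
    (h : Feasible n k m T) : 1 ≤ k * memoryScale k m T ε := by
  obtain ⟨-, hm, -, -, hTm⟩ := h.facts hk hT
  unfold memoryScale
  rw [← mul_div_assoc, le_div_iff₀ (by positivity), one_mul]
  have h1 := hTm.trans (sqrt_mul_mul_le hk hm)
  have h2 : ε ^ 2 ≤ 1 := pow_le_one₀ hε.le hε1
  nlinarith

lemma Feasible.edgeProb_spec (hk : 2 ≤ k) (hT : 0 < T) (hε : 0 < ε) (hε1 : ε ≤ 1)
    (h : Feasible n k m T) :
    0 < edgeProb n k m T ε ∧ edgeProb n k m T ε ≤ 1 ∧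
      edgeProb n k m T ε ≤ 2 * (128 * √(k * m) / (ε ^ 2 * T)) ∧
      (edgeProb n k m T ε = 1 ∨ 128 * √(k * m) / (ε ^ 2 * T) ≤ edgeProb n k m T ε) := by
  obtain ⟨-, hm, hmN, -, hTm⟩ := h.facts hk hT
  apply samplingThreshold_spec (hashPrime_prime n k).pos
  have h2 : ε ^ 2 ≤ 1 := pow_le_one₀ hε.le hε1
  have hmP : (m : ℝ) ≤ hashPrime n k := by exact_mod_cast hmN.trans (card_le_hashPrime n k)
  have h3 := one_le_sqrt_mul hk hm
  rw [div_mul_eq_mul_div, le_div_iff₀ (by positivity), one_mul]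
  have h4 : √((k : ℝ) * m) * m ≤ √(k * m) * hashPrime n k := by gcongr
  nlinarith

lemma Feasible.candidateProb_spec (hk : 2 ≤ k) (hT : 0 < T) (hε : 0 < ε) (hε1 : ε ≤ 1)
    (h : Feasible n k m T) :
    0 < candidateProb n k m T ε ∧ candidateProb n k m T ε ≤ 1 ∧
      candidateProb n k m T ε ≤ 2 * (128 / (ε ^ 2 * T) / edgeProb n k m T ε) ∧
      (candidateProb n k m T ε = 1 ∨
        128 / (ε ^ 2 * T) / edgeProb n k m T ε ≤ candidateProb n k m T ε) := by
  obtain ⟨-, -, -, hTN, -⟩ := h.facts hk hT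
  obtain ⟨hp0, hp1, -, -⟩ := h.edgeProb_spec hk hT hε hε1
  apply samplingThreshold_spec (hashPrime_prime n k).pos
  have h2 : ε ^ 2 ≤ 1 := pow_le_one₀ hε.le hε1
  have hTP : T ≤ hashPrime n k := hTN.trans (by exact_mod_cast card_le_hashPrime n k)
  rw [div_div, div_mul_eq_mul_div, le_div_iff₀ (by positivity), one_mul]
  have h3 : ε ^ 2 * T * edgeProb n k m T ε ≤ 1 * T * 1 := by gcongr
  linarith

lemma estimates_countingAlgorithm (hk : 2 ≤ k) (hT : 0 < T) (hε : 0 < ε) (hε1 : ε ≤ 1)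
    (hδ : 0 < δ) (H : KGraph (Fin n) k) (hm : H.edges.card = m) (hTH : T ≤ H.numSimplices)
    (σ : List (Finset (Fin n))) (hσ : H.IsStream σ) :
    (countingAlgorithm k n m T ε δ).Estimates σ H.numSimplices ε δ := by
  classical
  have hf : Feasible n k m T := ⟨H, hm, hTH⟩
  unfold countingAlgorithm
  rw [if_pos hf]
  obtain ⟨-, hm1, -, -, -⟩ := hf.facts hk hT
  obtain ⟨hp0, hp1, hp2, hp3⟩ := hf.edgeProb_spec hk hT hε hε1
  obtain ⟨hq0, hq1, hq2, hq3⟩ := hf.candidateProb_spec hk hT hε hε1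
  have hW := hf.one_le_memoryScale hk hT hε hε1
  have hτ := one_le_sqrt_mul hk hm1
  have hτm := sqrt_mul_mul_le hk hm1
  have hk1 : (1 : ℝ) ≤ k := by exact_mod_cast (by omega : 1 ≤ k)
  have hL : 16384 * (k + 1) * k ^ 2 * memoryScale k m T ε ≤ (memoryCap k m T ε : ℝ) :=
    Nat.le_ceil _
  have hWdef : (m : ℝ) ^ (2 - 1 / (k : ℝ)) = memoryScale k m T ε * (ε ^ 2 * T) := by
    unfold memoryScale
    field_simp
  set p := edgeProb n k m T ε with hp
  set q := candidateProb n k m T ε with hq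
  set W := memoryScale k m T ε with hWs
  set τ := √((k : ℝ) * m) with hτs
  have hεT : 0 < ε ^ 2 * T := by positivity
  have hpp : p * (ε ^ 2 * T) ≤ 256 * τ := by
    have := mul_le_mul_of_nonneg_right hp2 hεT.le
    have h2 : 2 * (128 * τ / (ε ^ 2 * T)) * (ε ^ 2 * T) = 256 * τ := by field_simp; norm_num
    linarith
  have hpq : p * q * (ε ^ 2 * T) ≤ 256 := by
    have := mul_le_mul_of_nonneg_right hq2 (mul_pos hp0 hεT).le
    have h2 : 2 * (128 / (ε ^ 2 * T) / p) * (p * (ε ^ 2 * T)) = 256 := by field_simp; norm_num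
    linarith
  -- If `p` is capped at one, the left side vanishes; otherwise `p` is at least its target value.
  have hv2 : (1 - p) * τ * 128 ≤ p * (ε ^ 2 * T) := by
    rcases hp3 with h | h
    · rw [h]
      linarith
    · rw [div_le_iff₀ hεT] at h
      have : 0 ≤ p * τ := by positivity
      nlinarith
  -- If `q` is capped at one, this follows from `hv2` because `τ ≥ 1`; otherwise `p * q` reaches its
  -- target.
  have hv1 : (1 - p * q) * 128 ≤ p * q * (ε ^ 2 * T) := by
    rcases hq3 with h | h
    · rw [h, mul_one]
      nlinarith
    · rw [div_div, div_le_iff₀ (by positivity)] at h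
      have : 0 ≤ p * q := by positivity
      nlinarith
  have hD : (∑ e ∈ H.edges, (H.minDeg e : ℝ)) ≤ k ^ 2 * (m : ℝ) ^ (2 - 1 / (k : ℝ)) := by
    rw [← hm]
    refine le_trans ?_ (H.mul_hyperarboricity_le hk)
    exact_mod_cast H.sum_minDeg_le_hyperarboricity hk
  have hWpos : 0 < W := by
    by_contra hneg
    have : (k : ℝ) * W ≤ 0 := mul_nonpos_of_nonneg_of_nonpos (by positivity) (not_lt.1 hneg)
    linarith
  have hLpos : 0 < memoryCap k m T ε := by
    have : (0 : ℝ) < memoryCap k m T ε := lt_of_lt_of_le (by positivity) hL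
    exact_mod_cast this
  have hpm : p * m ≤ 256 * k * W := by
    have h1 : p * m * (ε ^ 2 * T) ≤ 256 * k * W * (ε ^ 2 * T) := by
      have h2 := mul_le_mul_of_nonneg_right hpp (Nat.cast_nonneg m : (0 : ℝ) ≤ m)
      rw [hWdef] at hτm
      nlinarith
    exact le_of_mul_le_mul_right h1 hεT
  have hpqD : p * q * (∑ e ∈ H.edges, (H.minDeg e : ℝ)) ≤ 256 * k ^ 2 * W := by
    rw [hWdef] at hD
    calc p * q * (∑ e ∈ H.edges, (H.minDeg e : ℝ))
        ≤ p * q * (k ^ 2 * (W * (ε ^ 2 * T))) := by gcongr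
      _ = p * q * (ε ^ 2 * T) * (k ^ 2 * W) := by ring
      _ ≤ 256 * (k ^ 2 * W) := by gcongr
      _ = _ := by ring
  have hTpos : 0 < (H.numSimplices : ℝ) := hT.trans_le hTH
  have hkW : (k : ℝ) * W ≤ k ^ 2 * W := by
    have : (k : ℝ) ≤ k ^ 2 := by nlinarith
    gcongr
  obtain ⟨bad, hbad, hgood⟩ := exists_bad_seeds H hk hσ (exists_injective_hash n k).choose_spec
    (samplingThreshold_le _ _) (samplingThreshold_le _ _) p q ε hp.symm hq.symm hp0 hq0 hε
    (memoryCap k m T ε) hLpos hTpos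
    (by
      rw [hm]
      -- The capacity constant is `16384 = 64 * 256`: 64 from Markov, and 256 from the target
      -- constant 128 doubled by rounding.
      calc 64 * ((k : ℝ) + 1) * (p * m) ≤ 64 * (k + 1) * (256 * (k ^ 2 * W)) :=
            mul_le_mul_of_nonneg_left (by linarith) (by positivity)
        _ = 16384 * (k + 1) * k ^ 2 * W := by ring
        _ ≤ _ := hL)
    (by
      calc 64 * ((k : ℝ) + 1) * (p * q * ∑ e ∈ H.edges, (H.minDeg e : ℝ))
          ≤ 64 * (k + 1) * (256 * k ^ 2 * W) := by gcongr
        _ = 16384 * (k + 1) * k ^ 2 * W := by ring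
        _ ≤ _ := hL)
    (by
      refine hv1.trans ?_
      rw [← mul_assoc]
      gcongr)
    (by
      rw [hm, ← hτs]
      refine hv2.trans ?_
      rw [← mul_assoc]
      gcongr)
  subst hm
  refine SeededMachine.estimates_medianAlgorithm _ _ _ _ _ _ bad hbad hgood ?_
  have h1 : Real.logb 2 (2 / δ) ≤ (numCopies δ : ℝ) := Nat.le_ceil _
  rw [Real.logb_le_iff_le_rpow (by norm_num) (by positivity), Real.rpow_natCast,
    div_le_iff₀ hδ] at h1
  rw [div_le_iff₀ (by positivity)]
  linarith

/-- The seed has four residues and the code has `3 * L` slots; each of these takes at most `n ^ (2 *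
k + 5)` values. -/
lemma card_memory_le (hk : 2 ≤ k) (hn : k + 1 ≤ n) (hm : m ≤ Fintype.card (SmallSet n k)) (L : ℕ) :
    Fintype.card ((ZMod (hashPrime n k) × ZMod (hashPrime n k)) ×
        (ZMod (hashPrime n k) × ZMod (hashPrime n k))) * Fintype.card (SimplexCode n k m L) ≤
      n ^ ((2 * k + 5) * (4 + 3 * L)) := by
  have hn1 : 1 ≤ n := by omega
  have hN' : (n + 1) ^ (k + 1) ≤ n ^ (2 * k + 2) := by
    calc (n + 1) ^ (k + 1) ≤ (n ^ 2) ^ (k + 1) := Nat.pow_le_pow_left (by nlinarith) _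
      _ = n ^ (2 * k + 2) := by rw [← pow_mul]; rfl
  have hN : Fintype.card (SmallSet n k) ≤ n ^ (2 * k + 2) := (card_smallSet_le n k).trans hN'
  have hone : ∀ j, 1 ≤ n ^ j := fun j => Nat.one_le_pow _ _ hn1
  have hdouble : ∀ j, 2 * n ^ j ≤ n ^ (j + 1) := by
    intro j
    rw [pow_succ, mul_comm]
    gcongr
    omega
  have hmono : ∀ {i j : ℕ}, i ≤ j → n ^ i ≤ n ^ j := fun h => Nat.pow_le_pow_right hn1 h
  have hP : hashPrime n k ≤ n ^ (2 * k + 5) := by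
    have h1 := hashPrime_le n k
    have h2 : 2 * n ^ (2 * k + 2) ≤ n ^ (2 * k + 3) := hdouble (2 * k + 2)
    have h3 := hmono (show 2 * k + 3 ≤ 2 * k + 5 by omega)
    omega
  have hS : (n + 1) ^ (k + 1) + 1 ≤ n ^ (2 * k + 5) := by
    have h1 := hone (2 * k + 2)
    have h2 : 2 * n ^ (2 * k + 2) ≤ n ^ (2 * k + 3) := hdouble (2 * k + 2)
    have h3 := hmono (show 2 * k + 3 ≤ 2 * k + 5 by omega)
    omega
  have hC : n * (m + 1) + 1 ≤ n ^ (2 * k + 5) := by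
    have h1 := hone (2 * k + 2)
    have h2 : 2 * n ^ (2 * k + 2) ≤ n ^ (2 * k + 3) := hdouble (2 * k + 2)
    have h4 : n * (m + 1) ≤ n * n ^ (2 * k + 3) := Nat.mul_le_mul_left _ (by omega)
    have h3 : n * n ^ (2 * k + 3) = n ^ (2 * k + 4) := (pow_succ' n _).symm
    have h5 := hone (2 * k + 4)
    have h6 : 2 * n ^ (2 * k + 4) ≤ n ^ (2 * k + 5) := hdouble (2 * k + 4)
    omega
  refine (Nat.mul_le_mul_left _ (SimplexCode.card_le n k m L)).trans ?_
  rw [Fintype.card_prod, Fintype.card_prod, ZMod.card]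
  calc _ ≤ n ^ (2 * k + 5) * n ^ (2 * k + 5) * (n ^ (2 * k + 5) * n ^ (2 * k + 5)) *
        ((n ^ (2 * k + 5)) ^ L * ((n ^ (2 * k + 5)) ^ L * (n ^ (2 * k + 5)) ^ L)) := by gcongr
    _ = _ := by
      rw [pow_mul]
      generalize n ^ (2 * k + 5) = a
      ring

lemma Feasible.space_le (hk : 2 ≤ k) (hT : 0 < T) (hε : 0 < ε) (hε1 : ε ≤ 1)
    (hδ : 0 < δ) (hδ1 : δ < 1) (h : Feasible n k m T) :
    ((countingAlgorithm k n m T ε δ).space : ℝ) ≤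
      4 * (2 * k + 5) * (7 * k + 49152 * (k + 1) * k ^ 2) * memoryScale k m T ε *
        Real.logb 2 (2 / δ) * Real.logb 2 n := by
  classical
  obtain ⟨hn, hm1, hmN, -, -⟩ := h.facts hk hT
  have hW := h.one_le_memoryScale hk hT hε hε1
  have hspace : (countingAlgorithm k n m T ε δ).space ≤
      Nat.clog 2 n * ((2 * k + 5) * (4 + 3 * memoryCap k m T ε) * numCopies δ) := by
    unfold countingAlgorithm
    rw [if_pos h]
    unfold StreamAlgorithm.space
    rw [SeededMachine.card_state_medianAlgorithm]
    apply Nat.clog_le_of_le_pow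
    refine (Nat.pow_le_pow_left (card_memory_le hk hn hmN _) _).trans ?_
    rw [← pow_mul, pow_mul 2]
    exact Nat.pow_le_pow_left (Nat.le_pow_clog (by norm_num) n) _
  have hlog : (Nat.clog 2 n : ℝ) ≤ 2 * Real.logb 2 n := by
    have hn0 : (0 : ℝ) < n := by exact_mod_cast (by omega : 0 < n)
    have h1 : 1 ≤ Real.logb 2 n := by
      rw [Real.le_logb_iff_rpow_le (by norm_num) hn0]
      rw [Real.rpow_one]
      exact_mod_cast (by omega : 2 ≤ n)
    have h2 := Nat.ceil_lt_add_one (a := Real.logb 2 n) (by linarith)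
    have h3 := Real.natCeil_logb_natCast 2 n
    push_cast at h3
    rw [h3] at h2
    linarith
  have hcop : (numCopies δ : ℝ) ≤ 2 * Real.logb 2 (2 / δ) := by
    have h1 : 1 ≤ Real.logb 2 (2 / δ) := by
      rw [Real.le_logb_iff_rpow_le (by norm_num) (by positivity), Real.rpow_one,
        le_div_iff₀ hδ]
      linarith
    have h2 := Nat.ceil_lt_add_one (a := Real.logb 2 (2 / δ)) (by linarith)
    unfold numCopies
    linarith
  have hWnn : 0 ≤ memoryScale k m T ε := by
    unfold memoryScale
    positivity
  -- Four residues and the rounding of three capacities contribute at most `7`, absorbed through `1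
  -- ≤ k * memoryScale`; also `49152 = 3 * 16384`.
  have hcap : (4 + 3 * memoryCap k m T ε : ℝ) ≤
      (7 * k + 49152 * (k + 1) * k ^ 2) * memoryScale k m T ε := by
    have h2 := Nat.ceil_lt_add_one (a := 16384 * (k + 1) * k ^ 2 * memoryScale k m T ε)
      (by positivity)
    unfold memoryCap
    linarith
  have hspace' := (Nat.cast_le (α := ℝ)).2 hspace
  push_cast at hspace'
  refine hspace'.trans ?_
  have hl0 : 0 ≤ Real.logb 2 n := by linarith [(Nat.cast_nonneg (Nat.clog 2 n) : (0 : ℝ) ≤ _)]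
  calc (Nat.clog 2 n : ℝ) *
        ((2 * k + 5) * (4 + 3 * memoryCap k m T ε) * numCopies δ)
      ≤ (2 * Real.logb 2 n) * ((2 * k + 5) *
        ((7 * k + 49152 * (k + 1) * k ^ 2) * memoryScale k m T ε) *
          (2 * Real.logb 2 (2 / δ))) := by gcongr
    _ = _ := by ring

end Parameters

/-! ### The main theorem -/

theorem mainTheorem10 (k : ℕ) (hk : 2 ≤ k) :
    (∃ (C : ℝ) (c : ℕ)
        (A : (n m : ℕ) → (T ε δ : ℝ) → StreamAlgorithm (Finset (Fin n)) 4),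
      ∀ (n m : ℕ) (T ε δ : ℝ), 0 < T → 0 < ε → ε ≤ 1 → 0 < δ → δ < 1 →
        ((A n m T ε δ).space : ℝ) ≤
            C * ((ε ^ 2)⁻¹ * Real.logb 2 (2 / δ) * (Real.logb 2 (n : ℝ)) ^ c) *
              ((m : ℝ) ^ (2 - 1 / (k : ℝ)) / T) ∧
          ∀ H : KGraph (Fin n) k, H.edges.card = m → T ≤ (H.numSimplices : ℝ) →
            ∀ σ : List (Finset (Fin n)), H.IsStream σ →
              (A n m T ε δ).Estimates σ (H.numSimplices : ℝ) ε δ) ∧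
      (∃ C : ℝ, ∀ (n : ℕ) (H : KGraph (Fin n) k),
        (∑ e ∈ H.edges, (H.minDeg e : ℝ)) ≤
            (k : ℝ) * (H.edges.card : ℝ) * (H.hyperarboricity : ℝ) ∧
          (k : ℝ) * (H.edges.card : ℝ) * (H.hyperarboricity : ℝ) ≤
            C * (H.edges.card : ℝ) ^ (2 - 1 / (k : ℝ))) := by
  classical
  -- A single logarithm of `n` suffices, so `c = 1`. The leading 4 of the constant comes from the
  -- two logarithms, each at most doubled by rounding up.
  refine ⟨⟨4 * (2 * k + 5) * (7 * k + 49152 * (k + 1) * k ^ 2), 1, countingAlgorithm k, ?_⟩,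
    k ^ 2, fun n H => ⟨?_, H.mul_hyperarboricity_le hk⟩⟩
  · intro n m T ε δ hT hε hε1 hδ hδ1
    refine ⟨?_, fun H hm hTH σ hσ =>
      estimates_countingAlgorithm hk hT hε hε1 hδ H hm hTH σ hσ⟩
    by_cases h : Feasible n k m T
    · refine (h.space_le hk hT hε hε1 hδ hδ1).trans (le_of_eq ?_)
      unfold memoryScale
      rw [pow_one]
      field_simp
    · unfold countingAlgorithm
      rw [if_neg h, space_trivialAlgorithm, Nat.cast_zero]
      have h1 : 0 ≤ Real.logb 2 (2 / δ) := by
        apply Real.logb_nonneg (by norm_num)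
        rw [le_div_iff₀ hδ]
        linarith
      have h2 : 0 ≤ Real.logb 2 (n : ℝ) := by
        rcases Nat.eq_zero_or_pos n with rfl | hn
        · simp
        · exact Real.logb_nonneg (by norm_num) (by exact_mod_cast hn)
      positivity
  · exact_mod_cast H.sum_minDeg_le_hyperarboricity hk
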